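/- **Setting.** All graphs are finite, simple and undirected; $d(\cdot,\cdot)$ is the distance in $G$. A *burning schedule* is a finite sequence $A=\langle a_1,\dots,a_s\rangle$ of vertices. The burning process proceeds in rounds: in round $t\ge 1$ every neighbour of a burned vertex becomes burned and, if $t\le s$, so does $a_t$. $A$ burns $G$ within $k$ rounds if all vertices are burned after round $k$. The *burning number* $bn(G)$ is the least $k$ such that some schedule burns $G$ within $k$ rounds. A *tree decomposition* $\mathcal T$ of $G$ is a finite tree with a bag (a set of vertices of $G$) at each node such that both ends of every edge lie in a common bag, and for every vertex the nodes whose bags contain it form a non-empty connected subtree. Its *length* $tl$ is the maximum distance in $G$ of two vertices in a common bag. **Procedure BurnGuess.** Let $G$ be connected, $\mathcal T$ a tree decomposition of length $tl$, rooted at a bag $B_r$, $o\in B_r$ a vertex (the origin), and $g\ge 1$ an integer. Initially no vertex is marked. For $i=1,2,\dots,g+1$, as long as some vertex is unmarked: choose an unmarked vertex $t_i$ at maximum distance from $o$; let $B_i$ be the bag of minimum depth containing $t_i$; walk from $B_i$ towards the root until reaching the first bag $B_i'$ that is the root or all of whose vertices are at distance at least $g$ from $t_i$; choose any $c_i\in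 B_i'$; mark all vertices at distance at most $(2g-i+1)+4tl$ from $c_i$. If all vertices are marked at the end, return the schedule $\langle c_1,c_2,\dots\rangle$ of the chosen vertices; otherwise return "no-schedule". **Theorem.** 1. For every connected graph $G$, every tree decomposition $\mathcal T$ of length $tl$, every root bag $B_r$ and origin $o\in B_r$, every $g\ge1$ and every outcome of the arbitrary choices: if BurnGuess returns a schedule, this schedule burns $G$ within $2g+4tl+1$ rounds; if it returns "no-schedule", then no schedule burns $G$ within $g$ rounds. 2. There are an algorithm (a program for a random access machine with addition and truncated subtraction at unit cost), a polynomial $p$, and for every $L\in\mathbb N$ a function $\delta_L:\mathbb N\to\mathbb R$ with $\delta_L(x)\to0$ as $x\to\infty$, such that the following holds. Given a connected graph $G$ with $n$ vertices and a tree decomposition $\mathcal T$ of $G$ with $m$ bags, of length $tl$, the algorithm halts within $p(n+m)$ steps and outputs a schedule $A$ such that, for some root bag, some origin in it and some integer $g^*\ge1$, the schedule $A$ is returned by BurnGuess with parameter $g^*$, while "no-schedule" is a possible output of BurnGuess for every $1\le g<g^*$ (same root and origin). The schedule $A$ burns $G$ within $2g^*+4tl+1$ rounds, no schedule burns $G$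 in fewer than $g^*$ rounds, and the number of rounds in which $A$ burns $G$ is at most $$\Bigl(2+\frac{4tl+1}{g^*}\Bigr)\,bn(G).$$ Moreover $\frac{4tl+1}{g^*}\le\delta_L(\operatorname{diam}G)$ whenever $tl\le L$; so the approximation factor is $2+o(1)$ for bounded length $tl$ as the diameter of $G$ tends to infinity. -/

import Mathlib

namespace GraphBurning

/-! ### The burning process -/

/-- The set of burned vertices at the end of round `t` under the schedule `A` (`A[t]` is the
activator of round `t + 1`; when the schedule is exhausted no new fire is started). -/
def burned {V : Type*} (G : SimpleGraph V) (A : List V) : ℕ → Set V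
  | 0 => ∅
  | t + 1 => burned G A t ∪ {v | ∃ u ∈ burned G A t, G.Adj u v} ∪ {v | A[t]? = some v}

/-- Under the schedule `A` all vertices are burned at the end of round `k`. -/
def BurnsWithin {V : Type*} (G : SimpleGraph V) (A : List V) (k : ℕ) : Prop :=
  burned G A k = Set.univ

/-- The round in which the burning under the schedule `A` completes. -/
noncomputable def burnTime {V : Type*} (G : SimpleGraph V) (A : List V) : ℕ :=
  sInf {k | BurnsWithin G A k}

/-- The burning number `bn(G)`. -/
noncomputable def burningNumber {V : Type*} (G : SimpleGraph V) : ℕ :=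
  sInf {k | ∃ A : List V, BurnsWithin G A k}

/-! ### Tree decompositions -/

/-- A tree decomposition of `G` with bags indexed by the nodes `ι` of a tree. (`Connected`
includes non-emptiness, so every vertex lies in some bag.) -/
structure TreeDecomposition {V : Type*} (G : SimpleGraph V) (ι : Type*) where
  tree : SimpleGraph ι
  isTree : tree.IsTree
  bag : ι → Finset V
  edge_mem : ∀ v w, G.Adj v w → ∃ i, v ∈ bag i ∧ w ∈ bag i
  connected : ∀ v, (tree.induce {i | v ∈ bag i}).Connected

/-- The length of a decomposition: the maximum distance in `G` of two vertices in one bag. -/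
noncomputable def TreeDecomposition.length {V ι : Type*} [Fintype ι] {G : SimpleGraph V}
    (T : TreeDecomposition G ι) : ℕ :=
  Finset.univ.sup fun i => (T.bag i ×ˢ T.bag i).sup fun q => G.dist q.1 q.2

/-! ### The procedure `BurnGuess`

All the "arbitrary" choices of the procedure are left open: the definitions below are relations
that describe the possible runs. -/

section Procedure

variable {V ι : Type*} {G : SimpleGraph V}

/-- `t` is an unmarked vertex at maximum distance from the origin `o`. -/
def IsTerminal (G : SimpleGraph V) (o : V) (M : Set V) (t : V) : Prop :=
  t ∉ M ∧ ∀ u, u ∉ M → G.dist u o ≤ G.dist t o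

/-- `b` is a bag of minimum depth (for the root `r`) among the bags that contain `t`. -/
def IsTopBag (T : TreeDecomposition G ι) (r : ι) (t : V) (b : ι) : Prop :=
  t ∈ T.bag b ∧ ∀ b', t ∈ T.bag b' → T.tree.dist b r ≤ T.tree.dist b' r

/-- `p` is the parent of `b` when the tree is rooted at `r`. -/
def IsParent (T : TreeDecomposition G ι) (r b p : ι) : Prop :=
  T.tree.Adj b p ∧ T.tree.dist p r + 1 = T.tree.dist b r

/-- `Climb T r g t b b'`: walking from `b` towards the root `r`, and moving on as long as the
current bag is not the root and has a vertex at distance at most `g - 1` from `t`, one ends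
in `b'`. -/
inductive Climb (T : TreeDecomposition G ι) (r : ι) (g : ℕ) (t : V) : ι → ι → Prop
  | here (b : ι) (h : b = r ∨ ∀ v ∈ T.bag b, g ≤ G.dist v t) : Climb T r g t b b
  | move (b p b' : ι) (hr : b ≠ r) (hv : ∃ v ∈ T.bag b, G.dist v t < g)
      (hp : IsParent T r b p) (h : Climb T r g t p b') : Climb T r g t b b'

/-- `Reach T r o g i A M`: after `i` iterations of the main loop with parameter `g`, root `r` and
origin `o`, the activators chosen so far may be `A` and the set of marked vertices `M`. -/
inductive Reach [Fintype ι] (T : TreeDecomposition G ι) (r : ι) (o : V) (g : ℕ) :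
    ℕ → List V → Set V → Prop
  | init : Reach T r o g 0 [] ∅
  | iter (i : ℕ) (A : List V) (M : Set V) (t : V) (b b' : ι) (c : V)
      (h : Reach T r o g i A M) (hi : i ≤ g) (hM : M ≠ Set.univ)
      (ht : IsTerminal G o M t) (hb : IsTopBag T r t b) (hb' : Climb T r g t b b')
      (hc : c ∈ T.bag b') :
      Reach T r o g (i + 1) (A ++ [c])
        (M ∪ {u | G.dist u c ≤ (2 * g - (i + 1) + 1) + 4 * T.length})

/-- The possible outputs of `BurnGuess`; `none` stands for "no-schedule". -/
inductive BurnGuess [Fintype ι] (T : TreeDecomposition G ι) (r : ι) (o : V) (g : ℕ) :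
    Option (List V) → Prop
  | schedule (i : ℕ) (A : List V) (h : Reach T r o g i A Set.univ) :
      BurnGuess T r o g (some A)
  | noSchedule (i : ℕ) (A : List V) (M : Set V) (h : Reach T r o g i A M)
      (hM : M ≠ Set.univ) (hi : g < i) : BurnGuess T r o g none

end Procedure

/-! ### A random access machine with step count

Programs use registers and finitely many unbounded arrays of natural numbers. Every node of an
expression, every assignment and every test costs one step. There is no multiplication, so in `t`
steps no number grows by more than `t` bits, and polynomial time here is the usual one. -/

/-- Expressions: literals, registers, array cells, sum, truncated difference. -/
inductive RamExpr : Type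
  | lit (k : ℕ)
  | reg (x : ℕ)
  | arr (a : ℕ) (e : RamExpr)
  | add (e f : RamExpr)
  | sub (e f : RamExpr)

/-- Programs. A test succeeds when the value of the expression is not `0`. -/
inductive RamCmd : Type
  | skip
  | assign (x : ℕ) (e : RamExpr)
  | store (a : ℕ) (idx e : RamExpr)
  | seq (P Q : RamCmd)
  | ite (e : RamExpr) (P Q : RamCmd)
  | loop (e : RamExpr) (P : RamCmd)

/-- Contents of the registers and of the arrays. -/
structure RamState : Type where
  reg : ℕ → ℕ
  arr : ℕ → ℕ → ℕ

def RamExpr.val (s : RamState) : RamExpr → ℕ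
  | lit k => k
  | reg x => s.reg x
  | arr a e => s.arr a (e.val s)
  | add e f => e.val s + f.val s
  | sub e f => e.val s - f.val s

def RamExpr.cost : RamExpr → ℕ
  | lit _ => 1
  | reg _ => 1
  | arr _ e => e.cost + 1
  | add e f => e.cost + f.cost + 1
  | sub e f => e.cost + f.cost + 1

def RamState.setReg (s : RamState) (x k : ℕ) : RamState :=
  { s with reg := Function.update s.reg x k }

def RamState.setArr (s : RamState) (a j k : ℕ) : RamState :=
  { s with arr := Function.update s.arr a (Function.update (s.arr a) j k) }

/-- `Exec P s s' k`: the program `P` started in the state `s` halts in the state `s'` after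
exactly `k` steps. (`loop e P` is "while `e ≠ 0` do `P`".) -/
inductive Exec : RamCmd → RamState → RamState → ℕ → Prop
  | skip (s : RamState) : Exec .skip s s 1
  | assign (x : ℕ) (e : RamExpr) (s : RamState) :
      Exec (.assign x e) s (s.setReg x (e.val s)) (e.cost + 1)
  | store (a : ℕ) (idx e : RamExpr) (s : RamState) :
      Exec (.store a idx e) s (s.setArr a (idx.val s) (e.val s)) (idx.cost + e.cost + 1)
  | seq (P Q : RamCmd) (s s' s'' : RamState) (j k : ℕ) (hP : Exec P s s' j)
      (hQ : Exec Q s' s'' k) : Exec (.seq P Q) s s'' (j + k)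
  | iteTrue (e : RamExpr) (P Q : RamCmd) (s s' : RamState) (k : ℕ) (he : e.val s ≠ 0)
      (hP : Exec P s s' k) : Exec (.ite e P Q) s s' (e.cost + 1 + k)
  | iteFalse (e : RamExpr) (P Q : RamCmd) (s s' : RamState) (k : ℕ) (he : e.val s = 0)
      (hQ : Exec Q s s' k) : Exec (.ite e P Q) s s' (e.cost + 1 + k)
  | loopDone (e : RamExpr) (P : RamCmd) (s : RamState) (he : e.val s = 0) :
      Exec (.loop e P) s s (e.cost + 1)
  | loopStep (e : RamExpr) (P : RamCmd) (s s' s'' : RamState) (j k : ℕ) (he : e.val s ≠ 0)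
      (hP : Exec P s s' j) (hL : Exec (.loop e P) s' s'' k) :
      Exec (.loop e P) s s'' (e.cost + 1 + j + k)

open Classical in
/-- The input: register `0` holds the number `n` of vertices, register `1` the number `m` of bags;
array `0` is the adjacency matrix of `G`, array `1` the adjacency matrix of the tree, array `2`
the `m × n` incidence matrix of bags and vertices (all row by row). Everything else is `0`. -/
noncomputable def inputState {n m : ℕ} (G : SimpleGraph (Fin n))
    (T : TreeDecomposition G (Fin m)) : RamState where
  reg x := if x = 0 then n else if x = 1 then m else 0
  arr a k :=
    if (a = 0 ∧ ∃ u v : Fin n, G.Adj u v ∧ k = u.val * n + v.val) ∨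
       (a = 1 ∧ ∃ i j : Fin m, T.tree.Adj i j ∧ k = i.val * m + j.val) ∨
       (a = 2 ∧ ∃ (i : Fin m) (v : Fin n), v ∈ T.bag i ∧ k = i.val * n + v.val)
    then 1 else 0

/-- The output: register `0` holds the number of entries, array `3` the entries. -/
def RamState.output (s : RamState) : List ℕ :=
  (List.range (s.reg 0)).map (s.arr 3)

end GraphBurning

open GraphBurning

namespace GraphBurning

/-! ### Burned sets as unions of balls -/

section Burned

variable {V : Type*} {G : SimpleGraph V}

/-! After `k` rounds the fire is the union of the balls of radius `k - j - 1` about the activators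
with index `j < k`, counted from 0 (`mem_burned_iff`). So a returned schedule burns in time as soon
as its marked balls cover the graph: radius plus delay is the same number for every activator.

For a failed run, the terminals form a set of more than `g` vertices at pairwise distance above `2 *
g` (`Reach.exists_packing`). Within `g` rounds two of them would have to be burned from one
activator, whose ball has diameter below `2 * g` (`not_burnsWithin_of_packing`). The distances come
from `Climb.le_dist_terminal`. The bag of the activator `c` lies on the tree path from a bag of the
terminal `t` to the root, so it separates any bag of another vertex `u` from the root or from that
bag of `t`. Moreover `c` is within `g - 1 + 2 * tl` of `t` (`Climb.dist_le`). If `u` is still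
unmarked and were cut off from the root, a geodesic from `u` to the origin would cross the bag near
`c`, and `u` would be further from the origin than `t`. Hence the bag lies between `u` and `t` and
is not the root, so all its vertices are at distance at least `g` from `t`, and the two halves of a
geodesic from `u` to `t` add up to more than `2 * g`.

If `g` is the first successful parameter, then `bn(G) ≥ g`, which gives the factor. Since at most `g
+ 1` balls of radius `2 * g + 4 * tl` cover a diametral geodesic, the diameter is `O(g ^ 2)` for
bounded `tl`, so `(4 * tl + 1) / g` tends to 0.

For the algorithm, every choice in the procedure is a bounded search over vertices, bags or stored
activators once all distances are tabulated. Expressions with bounded search are compiled to the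
machine in polynomial time (`HExpr.compiles`), and `Triple` is a Hoare logic that hides the
polynomials. The parameter is raised until a call succeeds; this stops by `g = n`, because all
vertices listed in any order burn the graph within `n` rounds. -/

theorem mem_burned_iff (hG : G.Connected) (A : List V) (t : ℕ) (v : V) :
    v ∈ burned G A t ↔ ∃ j c, A[j]? = some c ∧ G.dist v c + j + 1 ≤ t := by
  induction t generalizing v with
  | zero => simp [burned]
  | succ t ih =>
    simp only [burned, Set.mem_union, Set.mem_ofPred_eq, ih]
    constructor
    · rintro ((⟨j, c, hj, h⟩ | ⟨u, ⟨j, c, hj, h⟩, hu⟩) | h)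
      · exact ⟨j, c, hj, by omega⟩
      · refine ⟨j, c, hj, ?_⟩
        have h1 : G.dist v c ≤ G.dist v u + G.dist u c := hG.dist_triangle
        have h2 : G.dist v u = 1 := SimpleGraph.dist_eq_one_iff_adj.2 hu.symm
        omega
      · exact ⟨t, v, h, by simp⟩
    · rintro ⟨j, c, hj, h⟩
      rcases Nat.lt_or_ge (G.dist v c + j) t with h1 | h1
      · exact Or.inl (Or.inl ⟨j, c, hj, by omega⟩)
      · obtain ⟨p, hp⟩ := hG.exists_walk_length_eq_dist v c
        cases p with
        | nil =>
          simp only [SimpleGraph.Walk.length_nil] at hp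
          have : j = t := by omega
          exact Or.inr (this ▸ hj)
        | cons hadj q =>
          rename_i w
          simp only [SimpleGraph.Walk.length_cons] at hp
          have := SimpleGraph.dist_le q
          exact Or.inl (Or.inr ⟨w, ⟨j, c, hj, by omega⟩, hadj.symm⟩)

theorem burnsWithin_iff (hG : G.Connected) (A : List V) (k : ℕ) :
    BurnsWithin G A k ↔ ∀ v, ∃ j c, A[j]? = some c ∧ G.dist v c + j + 1 ≤ k := by
  simp only [BurnsWithin, Set.eq_univ_iff_forall, mem_burned_iff hG]

/-- A set of more than `k` vertices at pairwise distance at least `2 * k` prevents burning within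
`k` rounds. -/
theorem not_burnsWithin_of_packing (hG : G.Connected) {A : List V} {k : ℕ} {F : Finset V}
    (hF : k < F.card) (hd : ∀ u ∈ F, ∀ v ∈ F, u ≠ v → 2 * k ≤ G.dist u v) :
    ¬ BurnsWithin G A k := by
  rw [burnsWithin_iff hG]
  intro h
  choose j c hj hk using h
  -- Pigeonhole: the index of the activator that burns a vertex is below `k`, so two vertices of `F`
  -- share one.
  obtain ⟨u, hu, v, hv, huv, he⟩ := Finset.exists_ne_map_eq_of_card_lt_of_maps_to
    (s := F) (t := Finset.range k) (f := j) (by simpa using hF)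
    (fun v _ => by have := hk v; simp only [Finset.coe_range, Set.mem_Iio]; omega)
  have h1 := hd u hu v hv huv
  have hc : c u = c v := by
    have := (hj u).symm.trans (he ▸ hj v)
    simpa using this
  have h2 : G.dist u v ≤ G.dist u (c u) + G.dist (c u) v := hG.dist_triangle
  have h3 := hk u
  have h4 := hk v
  rw [← hc, SimpleGraph.dist_comm] at h4
  omega

/-- Balls of radius `R` cover few levels of the distance from a vertex. -/
theorem dist_lt_of_cover (hG : G.Connected) (A : List V) (R : ℕ)
    (h : ∀ v, ∃ c ∈ A, G.dist v c ≤ R) (x y : V) : G.dist x y < A.length * (2 * R + 1) := by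
  classical
  -- A geodesic from `x` to `y` visits every level.
  have hlev : ∀ d ≤ G.dist x y, ∃ v, G.dist x v = d := by
    intro d hd
    obtain ⟨p, hp⟩ := hG.exists_walk_length_eq_dist x y
    refine ⟨p.getVert d, le_antisymm ?_ ?_⟩
    · have := SimpleGraph.dist_le (p.take d)
      rw [SimpleGraph.Walk.take_length] at this
      omega
    · have := SimpleGraph.dist_le (p.drop d)
      rw [SimpleGraph.Walk.drop_length] at this
      have h3 : G.dist x y ≤ G.dist x (p.getVert d) + G.dist (p.getVert d) y := hG.dist_triangle
      omega
  -- A ball of radius `R` meets only levels in an interval of at most `2 * R + 1` values.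
  have hsub : Finset.range (G.dist x y + 1) ⊆
      A.toFinset.biUnion fun c => Finset.Icc (G.dist x c - R) (G.dist x c + R) := by
    intro d hd
    obtain ⟨v, rfl⟩ := hlev d (by simpa [Nat.lt_succ_iff] using hd)
    obtain ⟨c, hc, hv⟩ := h v
    simp only [Finset.mem_biUnion, List.mem_toFinset, Finset.mem_Icc]
    have h1 : G.dist x c ≤ G.dist x v + G.dist v c := hG.dist_triangle
    have h2 : G.dist x v ≤ G.dist x c + G.dist c v := hG.dist_triangle
    rw [SimpleGraph.dist_comm (u := c)] at h2
    exact ⟨c, hc, by omega, by omega⟩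
  have h1 := Finset.card_le_card hsub
  have h2 : _ ≤ _ * (2 * R + 1) := Finset.card_biUnion_le_card_mul A.toFinset
    (fun c => Finset.Icc (G.dist x c - R) (G.dist x c + R)) (2 * R + 1)
    (fun c _ => by simp only [Nat.card_Icc]; omega)
  have h3 := Nat.mul_le_mul_right (2 * R + 1) A.toFinset_card_le
  rw [Finset.card_range] at h1
  omega

end Burned

/-! ### Separation properties of tree decompositions -/

section Separation

variable {V ι : Type*} {G : SimpleGraph V} (T : TreeDecomposition G ι)

/-- Consecutive vertices of a walk share a bag, so the pieces of the tree belonging to the single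
vertices link up to a chain. The graph `H` on the nodes is free, so that it can be the tree with
some edges removed. -/
theorem TreeDecomposition.reachable_of_walk {H : SimpleGraph ι} {u w : V} (p : G.Walk u w)
    (hp : ∀ v ∈ p.support, ∀ x y, v ∈ T.bag x → v ∈ T.bag y → H.Reachable x y) {x y : ι}
    (hx : u ∈ T.bag x) (hy : w ∈ T.bag y) : H.Reachable x y := by
  induction p generalizing x with
  | nil => exact hp _ (by simp) x y hx hy
  | cons hadj q ih =>
    obtain ⟨z, hz1, hz2⟩ := T.edge_mem _ _ hadj
    exact (hp _ (by simp) x z hx hz1).trans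
      (ih (fun v hv => hp v (by simp [hv])) hz2 hy)

theorem TreeDecomposition.reachable_of_mem {E : Set (Sym2 ι)} {v : V} {x y : ι}
    (hE : ∀ i j, v ∈ T.bag i → v ∈ T.bag j → s(i, j) ∉ E)
    (hx : v ∈ T.bag x) (hy : v ∈ T.bag y) : (T.tree.deleteEdges E).Reachable x y := by
  let f : T.tree.induce {i | v ∈ T.bag i} →g T.tree.deleteEdges E :=
    ⟨Subtype.val, fun {a b} h => by
      rw [SimpleGraph.deleteEdges_adj]
      exact ⟨h, hE _ _ a.2 b.2⟩⟩
  exact ((T.connected v).preconnected ⟨x, hx⟩ ⟨y, hy⟩).map f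

/-- The node `z` separates `x` from `y` in the tree of the decomposition. -/
def TreeDecomposition.Separates (z x y : ι) : Prop :=
  x = z ∨ y = z ∨ ¬ (T.tree.deleteEdges {e | z ∈ e}).Reachable x y

variable {T}

/-- The subtrees of the vertices of a walk that avoids the bag at `z` use no edge at `z`, and
chained together they would connect `x` to `y` around `z`. -/
theorem TreeDecomposition.Separates.exists_mem {z x y : ι} (h : T.Separates z x y) {u w : V}
    (p : G.Walk u w) (hx : u ∈ T.bag x) (hy : w ∈ T.bag y) : ∃ v ∈ p.support, v ∈ T.bag z := by
  by_contra! hc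
  rcases h with rfl | rfl | h
  · exact hc u (by simp) hx
  · exact hc w (by simp) hy
  · refine h (T.reachable_of_walk p (fun v hv a b ha hb => T.reachable_of_mem ?_ ha hb) hx hy)
    intro i j hi hj hz
    simp only [Set.mem_ofPred_eq, Sym2.mem_iff] at hz
    rcases hz with rfl | rfl
    · exact hc v hv hi
    · exact hc v hv hj

/-- Otherwise `w` would connect `x` and `y` without passing `z`. -/
theorem TreeDecomposition.Separates.or {z x y : ι} (h : T.Separates z x y) (w : ι) :
    T.Separates z w y ∨ T.Separates z w x := by
  unfold TreeDecomposition.Separates at *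
  by_contra! hc
  obtain ⟨⟨h1, h2, h3⟩, h4, h5, h6⟩ := hc
  rcases h with h | h | h
  · exact h5 h
  · exact h2 h
  · exact h (h6.symm.trans h3)

/-- A node on the geodesic lies on the only path from `x` to `y`, so no path can go around it. -/
theorem separates_of_dist_add {z x y : ι}
    (h : T.tree.dist x z + T.tree.dist z y = T.tree.dist x y) : T.Separates z x y := by
  classical
  rw [TreeDecomposition.Separates]
  by_contra! hc
  obtain ⟨hx, -, ⟨p⟩⟩ := hc
  have hz : z ∉ p.toPath.1.support := by
    -- With all edges at `z` removed, `z` is isolated: a walk starting elsewhere never reaches it.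
    have key : ∀ {a b : ι} (q : (T.tree.deleteEdges {e | z ∈ e}).Walk a b), a ≠ z →
        z ∉ q.support := by
      intro a b q
      induction q with
      | nil => intro h; simpa using h.symm
      | cons hadj q ih =>
        intro ha
        rw [SimpleGraph.deleteEdges_adj] at hadj
        simp only [Set.mem_ofPred_eq, Sym2.mem_iff, not_or] at hadj
        simp only [SimpleGraph.Walk.support_cons, List.mem_cons, not_or]
        exact ⟨ha.symm, ih (Ne.symm hadj.2.2)⟩
    exact key _ hx
  have hconn := T.isTree.connected
  obtain ⟨q1, h1⟩ := hconn.exists_walk_length_eq_dist x z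
  obtain ⟨q2, h2⟩ := hconn.exists_walk_length_eq_dist z y
  have hq : (q1.append q2).IsPath := SimpleGraph.Walk.isPath_of_length_eq_dist _ (by
    rw [SimpleGraph.Walk.length_append]; omega)
  let p' : T.tree.Walk x y := p.toPath.1.mapLe (SimpleGraph.deleteEdges_le _)
  have hp' : p'.IsPath := p.toPath.2.mapLe _
  have he := (T.isTree.isAcyclic.subsingleton_path x y).elim ⟨_, hq⟩ ⟨_, hp'⟩
  have he' : q1.append q2 = p' := congrArg Subtype.val he
  have hmem : z ∈ p'.support := by rw [← he']; simp
  simp only [p', SimpleGraph.Walk.support_mapLe_eq_support] at hmem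
  exact hz hmem

/-- If the two bags were disjoint, every vertex would keep its subtree connected after removal of
the edge between them. A walk in `G` down to the origin would then connect `b` to the root without
that edge, which is a bridge. -/
theorem IsParent.exists_mem_inter (hG : G.Connected) {r b p : ι} (h : IsParent T r b p) {v o : V}
    (hv : v ∈ T.bag b) (ho : o ∈ T.bag r) : ∃ x, x ∈ T.bag b ∧ x ∈ T.bag p := by
  classical
  by_contra! hc
  have hbr : ¬ (T.tree.deleteEdges {s(b, p)}).Reachable b p :=
    SimpleGraph.isBridge_iff.1
      (SimpleGraph.isAcyclic_iff_forall_adj_isBridge.1 T.isTree.isAcyclic h.1)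
  obtain ⟨w⟩ := hG.preconnected v o
  have h1 : (T.tree.deleteEdges {s(b, p)}).Reachable b r :=
    T.reachable_of_walk w (fun x _ i j hi hj => T.reachable_of_mem (by
      intro i j hi hj he
      simp only [Set.mem_singleton_iff, Sym2.eq_iff] at he
      rcases he with ⟨rfl, rfl⟩ | ⟨rfl, rfl⟩
      · exact hc x hi hj
      · exact hc x hj hi) hi hj) hv ho
  -- A geodesic from the parent to the root cannot use the edge, since `b` is further from the root.
  have h2 : (T.tree.deleteEdges {s(b, p)}).Reachable p r := by
    obtain ⟨q, hq⟩ := T.isTree.connected.exists_walk_length_eq_dist p r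
    rw [SimpleGraph.reachable_deleteEdges_iff_exists_walk]
    refine ⟨q, fun he => ?_⟩
    have hb := q.fst_mem_support_of_mem_edges he
    have h3 := SimpleGraph.dist_le (q.dropUntil b hb)
    have h4 := q.length_dropUntil_le_length hb
    have h5 := h.2
    omega
  exact hbr (h1.trans h2.symm)

end Separation

/-! ### The guarantees of the procedure -/

section Guarantees

variable {V ι : Type*} {G : SimpleGraph V} {T : TreeDecomposition G ι} {r : ι} {o : V} {g : ℕ}

theorem TreeDecomposition.dist_le_length [Fintype ι] (T : TreeDecomposition G ι) {i : ι} {u v : V}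
    (hu : u ∈ T.bag i) (hv : v ∈ T.bag i) : G.dist u v ≤ T.length :=
  (Finset.le_sup (f := fun q : V × V => G.dist q.1 q.2)
    (Finset.mem_product.2 ⟨hu, hv⟩ : (u, v) ∈ T.bag i ×ˢ T.bag i)).trans
    (Finset.le_sup (f := fun i => (T.bag i ×ˢ T.bag i).sup fun q => G.dist q.1 q.2)
      (Finset.mem_univ i))

theorem TreeDecomposition.length_le_iff [Fintype ι] (T : TreeDecomposition G ι) (k : ℕ) :
    T.length ≤ k ↔ ∀ i, ∀ u ∈ T.bag i, ∀ v ∈ T.bag i, G.dist u v ≤ k := by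
  refine ⟨fun h i u hu v hv => (T.dist_le_length hu hv).trans h, fun h => ?_⟩
  refine Finset.sup_le fun i _ => Finset.sup_le fun q hq => ?_
  rw [Finset.mem_product] at hq
  exact h i _ hq.1 _ hq.2

theorem Climb.dist_add {t : V} {b b' : ι} (h : Climb T r g t b b') :
    T.tree.dist b b' + T.tree.dist b' r = T.tree.dist b r := by
  induction h with
  | here b h => simp
  | move b p b' hr hv hp h ih =>
    have hc := T.isTree.connected
    have h1 : T.tree.dist b b' ≤ T.tree.dist b p + T.tree.dist p b' := hc.dist_triangle
    have h2 : T.tree.dist b r ≤ T.tree.dist b b' + T.tree.dist b' r := hc.dist_triangle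
    have h3 : T.tree.dist b p = 1 := SimpleGraph.dist_eq_one_iff_adj.2 hp.1
    have h4 := hp.2
    omega

theorem Climb.halts {t : V} {b b' : ι} (h : Climb T r g t b b') :
    b' = r ∨ ∀ v ∈ T.bag b', g ≤ G.dist v t := by
  induction h with
  | here b h => exact h
  | move b p b' hr hv hp h ih => exact ih

/-- The last bag left behind contains a vertex at distance below `g` from `t` and meets the final
bag; crossing each of the two bags costs at most one length. -/
theorem Climb.dist_le [Fintype ι] (hG : G.Connected) (ho : o ∈ T.bag r) {t : V} {b b' : ι}
    (h : Climb T r g t b b') (hb : ∃ v ∈ T.bag b, G.dist v t < g) {c : V} (hc : c ∈ T.bag b') :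
    G.dist c t + 1 ≤ g + 2 * T.length := by
  induction h with
  | here b h =>
    obtain ⟨v, hv, hvt⟩ := hb
    have h1 : G.dist c t ≤ G.dist c v + G.dist v t := hG.dist_triangle
    have := T.dist_le_length hc hv
    omega
  | move b p b' hr hv hp h ih =>
    -- If the parent has no vertex close to `t`, the climb ends there and `b` is the last bag left
    -- behind.
    by_cases hp' : ∃ v ∈ T.bag p, G.dist v t < g
    · exact ih hp' hc
    · cases h with
      | here _ _ =>
        obtain ⟨v, hv, hvt⟩ := hb
        obtain ⟨x, hx, hx'⟩ := hp.exists_mem_inter hG hv ho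
        have h1 : G.dist c t ≤ G.dist c x + G.dist x t := hG.dist_triangle
        have h2 : G.dist x t ≤ G.dist x v + G.dist v t := hG.dist_triangle
        have := T.dist_le_length hc hx'
        have := T.dist_le_length hx hv
        omega
      | move _ _ _ _ hv' _ _ => exact absurd hv' hp'

theorem TreeDecomposition.Separates.exists_dist [Fintype ι] (hG : G.Connected) {z x y : ι}
    (h : T.Separates z x y) {u w : V} (hx : u ∈ T.bag x) (hy : w ∈ T.bag y) :
    ∃ v ∈ T.bag z, G.dist u v + G.dist v w = G.dist u w := by
  classical
  obtain ⟨p, hp⟩ := hG.exists_walk_length_eq_dist u w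
  obtain ⟨v, hv, hz⟩ := h.exists_mem p hx hy
  refine ⟨v, hz, le_antisymm ?_ hG.dist_triangle⟩
  have h1 := SimpleGraph.dist_le (p.takeUntil v hv)
  have h2 := SimpleGraph.dist_le (p.dropUntil v hv)
  have h3 := congrArg SimpleGraph.Walk.length (p.take_spec hv)
  rw [SimpleGraph.Walk.length_append] at h3
  omega

/-- A vertex that is no further from the origin than the terminal `t`, and that remains unmarked
when the activator of `t` is placed, is far from `t`. -/
theorem Climb.le_dist_terminal [Fintype ι] (hG : G.Connected) (ho : o ∈ T.bag r) (hg : 1 ≤ g)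
    {t u c : V} {b b' : ι} (h : Climb T r g t b b') (hb : t ∈ T.bag b) (hc : c ∈ T.bag b')
    (hu : G.dist u o ≤ G.dist t o) (hd : g + 4 * T.length ≤ G.dist u c) :
    g + G.dist u c ≤ G.dist t u + T.length := by
  have hct := h.dist_le hG ho ⟨t, hb, by rw [SimpleGraph.dist_self]; omega⟩ hc
  have hsep : T.Separates b' b r := separates_of_dist_add h.dist_add
  obtain ⟨y, hy⟩ : ∃ y, u ∈ T.bag y := by
    obtain ⟨⟨y, hy⟩⟩ := (T.connected u).nonempty
    exact ⟨y, hy⟩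
  -- This is where `4 * T.length` is consumed: two lengths for replacing the crossing point `v` by
  -- `c` in both halves of the geodesic, two for the distance from `c` to `t`.
  have not_or : ¬ T.Separates b' y r := by
    intro hs
    obtain ⟨v, hv, he⟩ := hs.exists_dist hG hy ho
    have h1 : G.dist t o ≤ G.dist t c + G.dist c o := hG.dist_triangle
    have h2 : G.dist c o ≤ G.dist c v + G.dist v o := hG.dist_triangle
    have h3 : G.dist u c ≤ G.dist u v + G.dist v c := hG.dist_triangle
    have h4 := T.dist_le_length hc hv
    rw [SimpleGraph.dist_comm (u := t) (v := c)] at h1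
    rw [SimpleGraph.dist_comm (u := v) (v := c)] at h3
    omega
  -- The climb did not end at the root, since the root trivially separates everything from itself.
  have hall : ∀ v ∈ T.bag b', g ≤ G.dist v t := by
    rcases h.halts with rfl | h
    · exact absurd (Or.inr (Or.inl rfl)) not_or
    · exact h
  obtain ⟨v, hv, he⟩ := ((hsep.or y).resolve_left not_or).exists_dist hG hy hb
  have h1 := hall v hv
  have h3 : G.dist u c ≤ G.dist u v + G.dist v c := hG.dist_triangle
  have h4 := T.dist_le_length hv hc
  rw [SimpleGraph.dist_comm (u := t)]
  omega

/-- The set consists of the terminals chosen so far. The last clause says that any unmarked vertex,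
in particular the next terminal, may be added. -/
theorem Reach.exists_packing [Fintype ι] (hG : G.Connected) (ho : o ∈ T.bag r) (hg : 1 ≤ g)
    {i : ℕ} {A : List V} {M : Set V} (h : Reach T r o g i A M) :
    ∃ F : Finset V, F.card = i ∧ (∀ u ∈ F, ∀ v ∈ F, u ≠ v → 2 * g < G.dist u v) ∧
      ∀ u ∉ M, ∀ v ∈ F, 2 * g < G.dist u v := by
  classical
  induction h with
  | init => exact ⟨∅, by simp⟩
  | iter i A M t b b' c h hi hM ht hb hb' hc ih =>
    obtain ⟨F, hF, hd, hM⟩ := ih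
    have htF : t ∉ F := fun hmem => by simpa using hM t ht.1 t hmem
    refine ⟨insert t F, by rw [Finset.card_insert_of_notMem htF, hF], ?_, ?_⟩
    · intro u hu v hv huv
      rw [Finset.mem_insert] at hu hv
      rcases hu with rfl | hu <;> rcases hv with rfl | hv
      · exact absurd rfl huv
      · exact hM _ ht.1 v hv
      · rw [SimpleGraph.dist_comm]; exact hM _ ht.1 u hu
      · exact hd u hu v hv huv
    · intro u hu v hv
      simp only [Set.mem_union, Set.mem_ofPred_eq, not_or, not_le] at hu
      rw [Finset.mem_insert] at hv
      rcases hv with rfl | hv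
      -- As `i ≤ g`, the radius just used is at least `g + 4 * T.length`.
      · have := hb'.le_dist_terminal hG ho hg hb.1 hc (ht.2 u hu.1) (by omega)
        rw [SimpleGraph.dist_comm]
        omega
      · exact hM u hu.1 v hv

theorem BurnGuess.lt_of_none [Fintype ι] (hG : G.Connected) (ho : o ∈ T.bag r) (hg : 1 ≤ g)
    (h : BurnGuess T r o g none) {S : List V} {k : ℕ} (hS : BurnsWithin G S k) : g < k := by
  by_contra! hk
  cases h with
  | noSchedule i A M h hM hi =>
    obtain ⟨F, hF, hd, -⟩ := h.exists_packing hG ho hg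
    exact not_burnsWithin_of_packing (F := F) hG (by omega)
      (fun u hu v hv huv => by have := hd u hu v hv huv; omega) hS

/-- The vertices marked after the activators `A` have been chosen. -/
def marked [Fintype ι] (T : TreeDecomposition G ι) (g : ℕ) (A : List V) : Set V :=
  {u | ∃ j c, A[j]? = some c ∧ G.dist u c ≤ (2 * g - (j + 1) + 1) + 4 * T.length}

theorem marked_concat [Fintype ι] (T : TreeDecomposition G ι) (g : ℕ) (A : List V) (c : V) :
    marked T g (A ++ [c]) = marked T g A ∪
      {u | G.dist u c ≤ (2 * g - (A.length + 1) + 1) + 4 * T.length} := by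
  ext u
  simp only [marked, Set.mem_union, Set.mem_ofPred_eq]
  constructor
  · rintro ⟨j, d, hj, h⟩
    rcases lt_trichotomy j A.length with hlt | rfl | hgt
    · rw [List.getElem?_append_left hlt] at hj
      exact Or.inl ⟨j, d, hj, h⟩
    · simp only [List.getElem?_concat_length, Option.some.injEq] at hj
      exact Or.inr (hj ▸ h)
    · rw [List.getElem?_eq_none (by simp; omega)] at hj
      cases hj
  · rintro (⟨j, d, hj, h⟩ | h)
    · refine ⟨j, d, ?_, h⟩
      rw [List.getElem?_append_left]
      · exact hj
      · exact (List.getElem?_eq_some_iff.1 hj).1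
    · exact ⟨A.length, c, by simp, h⟩

/-- The marks are determined by the activators, so the program stores only the latter and recomputes
the former. -/
theorem Reach.length_eq [Fintype ι] {i : ℕ} {A : List V} {M : Set V} (h : Reach T r o g i A M) :
    A.length = i ∧ M = marked T g A ∧ (1 ≤ i → i ≤ g + 1) := by
  induction h with
  | init => simp [marked]
  | iter i A M t b b' c h hi hM ht hb hb' hc ih =>
    obtain ⟨rfl, rfl, -⟩ := ih
    refine ⟨by simp, by rw [marked_concat], by omega⟩

theorem BurnGuess.exists_dist_le [Fintype ι] (hg : 1 ≤ g) {A : List V}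
    (h : BurnGuess T r o g (some A)) :
    A.length ≤ g + 1 ∧
      ∀ v, ∃ j c, A[j]? = some c ∧ G.dist v c + j + 1 ≤ 2 * g + 4 * T.length + 1 := by
  cases h with
  | schedule i A h =>
    obtain ⟨hi, hM, hle⟩ := h.length_eq
    refine ⟨by omega, fun v => ?_⟩
    have hv : v ∈ marked T g A := hM ▸ Set.mem_univ v
    obtain ⟨j, c, hj, hd⟩ := hv
    have := (List.getElem?_eq_some_iff.1 hj).1
    -- Here `j ≤ g`, so the subtraction in the radius is not truncated, and radius plus `j + 1` is
    -- exactly the bound.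
    exact ⟨j, c, hj, by omega⟩

theorem BurnGuess.burnsWithin [Fintype ι] (hG : G.Connected) (hg : 1 ≤ g) {A : List V}
    (h : BurnGuess T r o g (some A)) : BurnsWithin G A (2 * g + 4 * T.length + 1) :=
  (burnsWithin_iff hG _ _).2 (h.exists_dist_le hg).2

end Guarantees

/-! ### The approximation factor -/

section Factor

/-- A bound on `(4 * tl + 1) / g` for decompositions of length `tl ≤ L` of graphs of diameter
`x`. -/
noncomputable def factorBound (L x : ℕ) : ℝ :=
  (4 * L + 1) * √((2 * (8 * L + 5) : ℝ) / (x + 1))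

theorem tendsto_factorBound (L : ℕ) :
    Filter.Tendsto (factorBound L) Filter.atTop (nhds 0) := by
  have h1 : Filter.Tendsto (fun x : ℕ => (2 * (8 * L + 5) : ℝ) / ((x : ℝ) + 1)) Filter.atTop
      (nhds 0) := by
    refine Filter.Tendsto.div_atTop tendsto_const_nhds ?_
    exact Filter.tendsto_atTop_add_const_right _ _ tendsto_natCast_atTop_atTop
  have h2 := (h1.sqrt).const_mul (4 * (L : ℝ) + 1)
  simp only [Real.sqrt_zero, mul_zero] at h2
  exact h2

variable {n m : ℕ} {G : SimpleGraph (Fin n)} {T : TreeDecomposition G (Fin m)} {r : Fin m}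
  {o : Fin n} {g : ℕ}

theorem BurnGuess.le_factorBound (hG : G.Connected) (hg : 1 ≤ g) {A : List (Fin n)}
    (h : BurnGuess T r o g (some A)) {L : ℕ} (hL : T.length ≤ L) :
    (4 * (T.length : ℝ) + 1) / (g : ℝ) ≤ factorBound L G.diam := by
  have := hG.nonempty
  obtain ⟨x, y, hxy⟩ := G.exists_dist_eq_diam
  obtain ⟨hA, hcov⟩ := h.exists_dist_le hg
  have h1 := dist_lt_of_cover hG A (2 * g + 4 * T.length) (fun v => by
    obtain ⟨j, c, hj, hd⟩ := hcov v
    exact ⟨c, List.mem_of_getElem? hj, by omega⟩) x y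
  rw [hxy] at h1
  have h2 : G.diam + 1 ≤ 2 * (8 * L + 5) * g ^ 2 := by
    have h3 : A.length ≤ 2 * g := by omega
    -- The left side is at most `4 * g + 8 * L + 1`, and `g ≥ 1` allows every term to be multiplied
    -- by `g`.
    have h4 : 2 * (2 * g + 4 * T.length) + 1 ≤ (8 * L + 5) * g := by nlinarith
    calc G.diam + 1 ≤ A.length * (2 * (2 * g + 4 * T.length) + 1) := h1
      _ ≤ (2 * g) * ((8 * L + 5) * g) := Nat.mul_le_mul h3 h4
      _ = _ := by ring
  have h2' : (G.diam : ℝ) + 1 ≤ 2 * (8 * L + 5) * (g : ℝ) ^ 2 := by exact_mod_cast h2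
  have hg' : (0 : ℝ) < g := by exact_mod_cast hg
  have h5 : 1 / (g : ℝ) ≤ √((2 * (8 * L + 5) : ℝ) / (G.diam + 1)) := by
    apply Real.le_sqrt_of_sq_le
    rw [div_pow, one_pow, div_le_div_iff₀ (by positivity) (by positivity)]
    linarith
  rw [factorBound, div_eq_mul_one_div]
  refine mul_le_mul ?_ h5 (by positivity) (by positivity)
  have : (T.length : ℝ) ≤ L := by exact_mod_cast hL
  linarith

theorem burnTime_le_mul_burningNumber (hg : 1 ≤ g) {A : List (Fin n)}
    (hA : BurnsWithin G A (2 * g + 4 * T.length + 1))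
    (hlow : ∀ (S : List (Fin n)) (k : ℕ), BurnsWithin G S k → g ≤ k) :
    (burnTime G A : ℝ) ≤
      (2 + (4 * (T.length : ℝ) + 1) / (g : ℝ)) * (burningNumber G : ℝ) := by
  have h1 : burnTime G A ≤ 2 * g + 4 * T.length + 1 := Nat.sInf_le hA
  have h2 : g ≤ burningNumber G := by
    refine le_csInf ⟨_, A, hA⟩ ?_
    rintro k ⟨S, hS⟩
    exact hlow S k hS
  have hg' : (0 : ℝ) < g := by exact_mod_cast hg
  calc (burnTime G A : ℝ) ≤ 2 * g + 4 * T.length + 1 := by exact_mod_cast h1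
    _ = (2 + (4 * (T.length : ℝ) + 1) / (g : ℝ)) * g := by field_simp; ring
    _ ≤ _ := by
      refine mul_le_mul_of_nonneg_left (by exact_mod_cast h2) (by positivity)

theorem le_of_burnsWithin (hG : G.Connected) (ho : o ∈ T.bag r)
    (h : ∀ g' : ℕ, 1 ≤ g' → g' < g → BurnGuess T r o g' none) (S : List (Fin n)) (k : ℕ)
    (hS : BurnsWithin G S k) : g ≤ k := by
  rcases Nat.lt_or_ge g 2 with h1 | h1
  -- For `g = 1` there is no smaller parameter to fail; instead, nothing is burned after round 0.
  · have : k ≠ 0 := by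
      rintro rfl
      have : o ∈ burned G S 0 := hS ▸ Set.mem_univ o
      exact this
    omega
  · have := (h (g - 1) (by omega) (by omega)).lt_of_none hG ho (by omega) hS
    omega

theorem BurnGuess.lt_card_of_none (hG : G.Connected) (ho : o ∈ T.bag r) (hg : 1 ≤ g)
    (h : BurnGuess T r o g none) : g < n := by
  refine h.lt_of_none hG ho hg (S := List.finRange n) ((burnsWithin_iff hG _ _).2 fun v => ?_)
  -- Each vertex is its own activator and burns by round `v + 1 ≤ n`.
  exact ⟨v, v, by simp, by simp⟩

end Factor

/-! ### States -/

namespace RamState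

@[simp] theorem setReg_reg (s : RamState) (x k y : ℕ) :
    (s.setReg x k).reg y = if y = x then k else s.reg y := by
  simp [setReg, Function.update_apply]

@[simp] theorem setReg_arr (s : RamState) (x k : ℕ) : (s.setReg x k).arr = s.arr := rfl

@[simp] theorem setArr_reg (s : RamState) (a j k : ℕ) : (s.setArr a j k).reg = s.reg := rfl

@[simp] theorem setArr_arr (s : RamState) (a j k b i : ℕ) :
    (s.setArr a j k).arr b i = if b = a ∧ i = j then k else s.arr b i := by
  simp only [setArr, Function.update_apply]
  by_cases hb : b = a
  · subst hb
    by_cases hi : i = j <;> simp [hi]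
  · simp [hb]

@[ext] theorem ext {s t : RamState} (h1 : ∀ x, s.reg x = t.reg x)
    (h2 : ∀ a i, s.arr a i = t.arr a i) : s = t := by
  cases s; cases t
  simp only [mk.injEq]
  exact ⟨funext h1, funext fun a => funext (h2 a)⟩

end RamState

theorem eval_le_eval_of_le (p : Polynomial ℕ) {a b : ℕ} (h : a ≤ b) : p.eval a ≤ p.eval b := by
  rw [Polynomial.eval_eq_sum_range, Polynomial.eval_eq_sum_range]
  gcongr

/-! ### Expressions with bounded search -/

/-- The least `j < N` with `f j ≠ 0`, and `N` if there is none. -/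
noncomputable def least (N : ℕ) (f : ℕ → ℕ) : ℕ := sInf {j | N ≤ j ∨ f j ≠ 0}

theorem least_le (N : ℕ) (f : ℕ → ℕ) : least N f ≤ N := Nat.sInf_le (Or.inl le_rfl)

theorem least_spec {N : ℕ} {f : ℕ → ℕ} (h : least N f < N) : f (least N f) ≠ 0 := by
  have : least N f ∈ {j | N ≤ j ∨ f j ≠ 0} := Nat.sInf_mem ⟨N, Or.inl le_rfl⟩
  rcases this with h' | h'
  · omega
  · exact h'

theorem least_min {N j : ℕ} {f : ℕ → ℕ} (h : f j ≠ 0) : least N f ≤ j := Nat.sInf_le (Or.inr h)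

theorem least_lt_iff {N : ℕ} {f : ℕ → ℕ} : least N f < N ↔ ∃ j < N, f j ≠ 0 :=
  ⟨fun h => ⟨_, h, least_spec h⟩, fun ⟨_, hj, h⟩ => (least_min h).trans_lt hj⟩

theorem least_eq {N k : ℕ} {f : ℕ → ℕ} (hk : k ≤ N) (h : k < N → f k ≠ 0)
    (hmin : ∀ j < k, f j = 0) : least N f = k := by
  refine le_antisymm ?_ ?_
  · rcases hk.lt_or_eq with h' | rfl
    · exact least_min (h h')
    · exact least_le _ _
  · by_contra! hlt
    exact least_spec (hlt.trans_le hk) (hmin _ hlt)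

/-- Expressions: those of the machine, the product `e * reg y` and the least `j < reg y` for which
`e` does not vanish when register `x` holds `j` (`reg y` if there is none). -/
inductive HExpr : Type
  | lit (k : ℕ)
  | reg (x : ℕ)
  | arr (a : ℕ) (e : HExpr)
  | add (e f : HExpr)
  | sub (e f : HExpr)
  | mul (e : HExpr) (y : ℕ)
  | find (x y : ℕ) (e : HExpr)

namespace HExpr

noncomputable def val : HExpr → RamState → ℕ
  | lit k, _ => k
  | reg x, s => s.reg x
  | arr a e, s => s.arr a (e.val s)
  | add e f, s => e.val s + f.val s
  | sub e f, s => e.val s - f.val s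
  | mul e y, s => e.val s * s.reg y
  | find x y e, s => least (s.reg y) fun j => e.val (s.setReg x j)

/-- The free variables are in `S`, the bound ones are increasing, larger than those in `S` and less
than `100`, and the bounds are among the registers `0`, `1`, `2`. -/
def wf : List ℕ → HExpr → Bool
  | _, lit _ => true
  | S, reg x => decide (x ∈ S)
  | S, arr _ e => e.wf S
  | S, add e f => e.wf S && f.wf S
  | S, sub e f => e.wf S && f.wf S
  | S, mul e y => decide (y ∈ S ∧ y < 3) && e.wf S
  | S, find x y e => decide ((∀ z ∈ S, z < x) ∧ x < 100 ∧ y ∈ S ∧ y < 3) && e.wf (x :: S)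

/-- A program that writes the value of the expression into register `t`, with the registers from
`t` on as scratch space. -/
def compile : ℕ → HExpr → RamCmd
  | t, lit k => .assign t (.lit k)
  | t, reg x => .assign t (.reg x)
  | t, arr a e => .seq (e.compile t) (.assign t (.arr a (.reg t)))
  | t, add e f =>
    .seq (e.compile t) (.seq (f.compile (t + 1)) (.assign t (.add (.reg t) (.reg (t + 1)))))
  | t, sub e f =>
    .seq (e.compile t) (.seq (f.compile (t + 1)) (.assign t (.sub (.reg t) (.reg (t + 1)))))
  -- Repeated addition: register `t + 1` accumulates, register `t + 2` counts down.
  | t, mul e y =>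
    .seq (e.compile t) (.seq (.assign (t + 1) (.lit 0)) (.seq (.assign (t + 2) (.reg y))
      (.seq (.loop (.reg (t + 2))
        (.seq (.assign (t + 1) (.add (.reg (t + 1)) (.reg t)))
          (.assign (t + 2) (.sub (.reg (t + 2)) (.lit 1)))))
        (.assign t (.reg (t + 1))))))
  -- Register `t` holds the number of candidates left and is set to 0 on success, so that in both
  -- cases `x` holds the answer when the loop ends.
  | t, find x y e =>
    .seq (.assign x (.lit 0)) (.seq (.assign t (.reg y))
      (.seq (.loop (.reg t)
        (.seq (e.compile (t + 1))
          (.ite (.reg (t + 1)) (.assign t (.lit 0))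
            (.seq (.assign x (.add (.reg x) (.lit 1))) (.assign t (.sub (.reg y) (.reg x)))))))
        (.assign t (.reg x))))

/-- Compiled code overwrites scratch registers and bound variables; this shows that such changes do
not affect later evaluations. -/
theorem val_congr (e : HExpr) : ∀ {S : List ℕ} {s s' : RamState}, e.wf S = true →
    (∀ x ∈ S, s'.reg x = s.reg x) → s'.arr = s.arr → e.val s' = e.val s := by
  induction e with
  | lit k => intros; rfl
  | reg x =>
    intro S s s' hw hr _
    exact hr x (by simpa [wf] using hw)
  | arr a e ih =>
    intro S s s' hw hr ha
    simp only [val, ih (by simpa [wf] using hw) hr ha, ha]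
  | add e f ih1 ih2 =>
    intro S s s' hw hr ha
    simp only [wf, Bool.and_eq_true] at hw
    simp only [val, ih1 hw.1 hr ha, ih2 hw.2 hr ha]
  | sub e f ih1 ih2 =>
    intro S s s' hw hr ha
    simp only [wf, Bool.and_eq_true] at hw
    simp only [val, ih1 hw.1 hr ha, ih2 hw.2 hr ha]
  | mul e y ih =>
    intro S s s' hw hr ha
    simp only [wf, Bool.and_eq_true, decide_eq_true_eq] at hw
    simp only [val, ih hw.2 hr ha, hr y hw.1.1]
  | find x y e ih =>
    intro S s s' hw hr ha
    simp only [wf, Bool.and_eq_true, decide_eq_true_eq] at hw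
    obtain ⟨⟨h1, h2, h3, -⟩, h4⟩ := hw
    simp only [val, hr y h3]
    congr 1
    funext j
    refine ih h4 (fun z hz => ?_) ha
    rw [List.mem_cons] at hz
    rcases hz with rfl | hz
    · simp
    · simp [hr z hz]

/-- `s'` agrees with `s` on the arrays, on the registers in `S` and on the scratch registers
below `t`. -/
def Agree (S : List ℕ) (t : ℕ) (s s' : RamState) : Prop :=
  s'.arr = s.arr ∧ (∀ x ∈ S, s'.reg x = s.reg x) ∧ ∀ x, 100 ≤ x → x < t → s'.reg x = s.reg x

theorem Agree.trans {S : List ℕ} {t : ℕ} {s s' s'' : RamState} (h : Agree S t s s')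
    (h' : Agree S t s' s'') : Agree S t s s'' :=
  ⟨h'.1.trans h.1, fun x hx => (h'.2.1 x hx).trans (h.2.1 x hx),
    fun x h1 h2 => (h'.2.2 x h1 h2).trans (h.2.2 x h1 h2)⟩

theorem Agree.mono {S S' : List ℕ} {t t' : ℕ} {s s' : RamState} (h : Agree S' t' s s')
    (hS : ∀ x ∈ S, x ∈ S') (ht : t ≤ t') : Agree S t s s' :=
  ⟨h.1, fun x hx => h.2.1 x (hS x hx), fun x h1 h2 => h.2.2 x h1 (by omega)⟩

theorem agree_setReg {S : List ℕ} {t : ℕ} (s : RamState) {x k : ℕ} (hx : x ∉ S)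
    (h : x < 100 ∨ t ≤ x) : Agree S t s (s.setReg x k) := by
  refine ⟨rfl, fun z hz => ?_, fun z h1 h2 => ?_⟩
  · have : z ≠ x := fun h => hx (h ▸ hz)
    simp [this]
  · have : z ≠ x := by omega
    simp [this]

/-- The compiled expression runs in polynomial time and computes the value. -/
def Compiles (S : List ℕ) (t : ℕ) (e : HExpr) : Prop :=
  ∃ p : Polynomial ℕ, ∀ s N, (∀ y ∈ S, y < 3 → s.reg y ≤ N) →
    ∃ s' k, Exec (e.compile t) s s' k ∧ k ≤ p.eval N ∧ s'.reg t = e.val s ∧ Agree S t s s'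

theorem compiles_mul {S : List ℕ} (hS : ∀ x ∈ S, x < 100) {t y : ℕ} (ht : 100 ≤ t) {e : HExpr}
    (hy : y ∈ S ∧ y < 3) (he : Compiles S t e) : Compiles S t (mul e y) := by
  obtain ⟨p, hp⟩ := he
  refine ⟨p + 10 * Polynomial.X + 20, fun s N hN => ?_⟩
  obtain ⟨s1, k1, hx1, hk1, hv1, ha1⟩ := hp s N hN
  have hnot : ∀ j, t + j ∉ S := fun j h => by have := hS _ h; omega
  have hloop : ∀ (j : ℕ) (s2 : RamState), s2.reg (t + 2) = j →
      ∃ s3 k, Exec (.loop (.reg (t + 2))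
        (.seq (.assign (t + 1) (.add (.reg (t + 1)) (.reg t)))
          (.assign (t + 2) (.sub (.reg (t + 2)) (.lit 1))))) s2 s3 k ∧ k ≤ 10 * j + 2 ∧
        s3.reg (t + 1) = s2.reg (t + 1) + s2.reg t * j ∧ Agree S (t + 1) s2 s3 := by
    intro j
    induction j with
    | zero =>
      intro s2 h2
      exact ⟨s2, _, .loopDone _ _ _ h2, by simp [RamExpr.cost], by simp, rfl, by simp, by simp⟩
    | succ j ih =>
      intro s2 h2
      obtain ⟨s3, k, hx, hk, hv, ha⟩ := ih
        ((s2.setReg (t + 1) (s2.reg (t + 1) + s2.reg t)).setReg (t + 2) (s2.reg (t + 2) - 1))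
        (by simp [h2])
      refine ⟨s3, _, .loopStep _ _ _ _ _ _ _ (by simp [RamExpr.val, h2])
        (.seq _ _ _ _ _ _ _ (.assign _ _ _) (.assign _ _ _))
        (by simpa [RamExpr.val] using hx), ?_, ?_, ?_⟩
      · simp only [RamExpr.cost]; omega
      · rw [hv]; simp; ring
      · refine Agree.trans ?_ ha
        exact (agree_setReg _ (hnot 1) (by omega)).trans (agree_setReg _ (hnot 2) (by omega))
  obtain ⟨s3, k3, hx3, hk3, hv3, ha3⟩ := hloop (s.reg y)
    ((s1.setReg (t + 1) 0).setReg (t + 2) (s.reg y)) (by simp)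
  have hy1 : s1.reg y = s.reg y := ha1.2.1 y hy.1
  have hy2 : y ≠ t + 1 := by omega
  refine ⟨s3.setReg t (s3.reg (t + 1)), _, .seq _ _ _ _ _ _ _ hx1 (.seq _ _ _ _ _ _ _
    (.assign _ _ _) (.seq _ _ _ _ _ _ _ (.assign _ _ _) (.seq _ _ _ _ _ _ _
      (by simpa [RamExpr.val, hy1, hy2] using hx3) (.assign _ _ _)))), ?_, ?_, ?_⟩
  · have := hN y hy.1 hy.2
    simp only [RamExpr.cost, Polynomial.eval_add, Polynomial.eval_mul, Polynomial.eval_X,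
      Polynomial.eval_ofNat]
    omega
  · simp [val, hv3, hv1]
  · exact (((ha1.trans (agree_setReg _ (hnot 1) (by omega))).trans
      (agree_setReg _ (hnot 2) (by omega))).trans (ha3.mono (fun _ h => h) (by omega))).trans
      (agree_setReg _ (hnot 0) (by omega))

theorem compiles_find {S : List ℕ} (hS : ∀ x ∈ S, x < 100) {t x y : ℕ} (ht : 100 ≤ t) {e : HExpr}
    (hx : (∀ z ∈ S, z < x) ∧ x < 100 ∧ y ∈ S ∧ y < 3) (hw : e.wf (x :: S) = true)
    (he : Compiles (x :: S) (t + 1) e) : Compiles S t (find x y e) := by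
  obtain ⟨p, hp⟩ := he
  obtain ⟨h1, h2, h3, h4⟩ := hx
  refine ⟨Polynomial.X * (p + 20) + p + 30, fun s N hN => ?_⟩
  have hnot : ∀ j, t + j ∉ S := fun j h => by have := hS _ h; omega
  have hxS : x ∉ S := fun h => (h1 x h).false
  have hyx : y ≠ x := fun h => hxS (h ▸ h3)
  have hty : y ≠ t := by omega
  have htx : x ≠ t := by omega
  set f : ℕ → ℕ := fun j => e.val (s.setReg x j) with hf
  -- `j` candidates have been rejected and `i` remain.
  have hloop : ∀ (i j : ℕ) (s2 : RamState), i + j = s.reg y → (∀ j' < j, f j' = 0) →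
      s2.reg x = j → s2.reg t = i → Agree S t s s2 →
      ∃ s3 k, Exec (.loop (.reg t)
        (.seq (e.compile (t + 1))
          (.ite (.reg (t + 1)) (.assign t (.lit 0))
            (.seq (.assign x (.add (.reg x) (.lit 1))) (.assign t (.sub (.reg y) (.reg x)))))))
          s2 s3 k ∧ k ≤ i * (p.eval N + 20) + p.eval N + 20 ∧
        s3.reg x = least (s.reg y) f ∧ Agree S t s s3 := by
    intro i
    induction i with
    | zero =>
      intro j s2 hij hmin hj hi ha
      refine ⟨s2, _, .loopDone _ _ _ hi, by simp only [RamExpr.cost]; omega, ?_, ha⟩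
      rw [hj, least_eq (by omega) (by omega) hmin]
    | succ i ih =>
      intro j s2 hij hmin hj hi ha
      -- The search variable may itself be a possible bound for inner searches; its value does not
      -- exceed `reg y`.
      have hN2 : ∀ z ∈ x :: S, z < 3 → s2.reg z ≤ N := by
        intro z hz hz3
        rw [List.mem_cons] at hz
        rcases hz with rfl | hz
        · have := hN y h3 h4
          omega
        · rw [ha.2.1 z hz]; exact hN z hz hz3
      obtain ⟨s3, k3, hx3, hk3, hv3, ha3⟩ := hp s2 N hN2
      have hval : e.val s2 = f j := by
        refine val_congr e hw (fun z hz => ?_) ha.1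
        rw [List.mem_cons] at hz
        rcases hz with rfl | hz
        · simp [hj]
        · have : z ≠ x := fun h => hxS (h ▸ hz)
          simp [this, ha.2.1 z hz]
      have ha3' : Agree S t s s3 := ha.trans (ha3.mono (by simp +contextual) (by omega))
      have hxj : s3.reg x = j := by rw [ha3.2.1 x (by simp), hj]
      by_cases hz : f j = 0
      · obtain ⟨s4, k4, hx4, hk4, hv4, ha4⟩ := ih (j + 1)
          ((s3.setReg x (j + 1)).setReg t (s.reg y - (j + 1))) (by omega)
          (fun j' hj' => by
            rcases Nat.lt_succ_iff_lt_or_eq.1 hj' with h | rfl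
            · exact hmin j' h
            · exact hz) (by simp [htx]) (by simp; omega)
          ((ha3'.trans (agree_setReg _ hxS (by omega))).trans
            (agree_setReg _ (hnot 0) (by omega)))
        refine ⟨s4, _, .loopStep _ _ _ _ _ _ _ (by simp [RamExpr.val, hi])
          (.seq _ _ _ _ _ _ _ hx3 (.iteFalse _ _ _ _ _ _ (by simp [RamExpr.val, hv3, hval, hz])
            (.seq _ _ _ _ _ _ _ (.assign _ _ _) (.assign _ _ _))))
          (by simpa [RamExpr.val, hxj, hyx, ha3'.2.1 y h3] using hx4), ?_, hv4, ha4⟩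
        simp only [RamExpr.cost]
        rw [Nat.add_mul]
        omega
      · refine ⟨s3.setReg t 0, _, .loopStep _ _ _ _ _ _ _ (by simp [RamExpr.val, hi])
          (.seq _ _ _ _ _ _ _ hx3 (.iteTrue _ _ _ _ _ _ (by simp [RamExpr.val, hv3, hval, hz])
            (.assign _ _ _)))
          (.loopDone _ _ _ (by simp [RamExpr.val])), ?_, ?_,
          ha3'.trans (agree_setReg _ (hnot 0) (by omega))⟩
        · simp only [RamExpr.cost]
          rw [Nat.add_mul]
          omega
        · simp only [RamState.setReg_reg, htx, if_false, hxj]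
          exact (least_eq (by omega) (fun _ => hz) hmin).symm
  obtain ⟨s3, k3, hx3, hk3, hv3, ha3⟩ := hloop (s.reg y) 0
    ((s.setReg x 0).setReg t (s.reg y)) (by omega) (by simp) (by simp [htx]) (by simp)
    ((agree_setReg _ hxS (by omega)).trans (agree_setReg _ (hnot 0) (by omega)))
  refine ⟨s3.setReg t (s3.reg x), _, .seq _ _ _ _ _ _ _ (.assign _ _ _)
    (.seq _ _ _ _ _ _ _ (.assign _ _ _) (.seq _ _ _ _ _ _ _
      (by simpa [RamExpr.val, hyx] using hx3) (.assign _ _ _))), ?_, ?_, ?_⟩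
  · have := Nat.mul_le_mul_right (p.eval N + 20) (hN y h3 h4)
    simp only [RamExpr.cost, Polynomial.eval_add, Polynomial.eval_mul, Polynomial.eval_X,
      Polynomial.eval_ofNat]
    omega
  · simp [val, hv3, hf]
  · exact ha3.trans (agree_setReg _ (hnot 0) (by omega))

theorem compiles_binary {S : List ℕ} (hS : ∀ x ∈ S, x < 100) {t : ℕ} (ht : 100 ≤ t)
    {e f h : HExpr} (op : RamExpr → RamExpr → RamExpr) (op' : ℕ → ℕ → ℕ)
    (hcost : ∀ a b, (op a b).cost = a.cost + b.cost + 1)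
    (hop : ∀ a b s, (op a b).val s = op' (a.val s) (b.val s))
    (hc : h.compile t = .seq (e.compile t) (.seq (f.compile (t + 1))
      (.assign t (op (.reg t) (.reg (t + 1))))))
    (hval : ∀ s, h.val s = op' (e.val s) (f.val s)) (hw : f.wf S = true)
    (he : Compiles S t e) (hf : Compiles S (t + 1) f) : Compiles S t h := by
  obtain ⟨p, hp⟩ := he
  obtain ⟨q, hq⟩ := hf
  refine ⟨p + q + 4, fun s N hN => ?_⟩
  obtain ⟨s1, k1, hx1, hk1, hv1, ha1⟩ := hp s N hN
  obtain ⟨s2, k2, hx2, hk2, hv2, ha2⟩ := hq s1 N (fun y hy h => by rw [ha1.2.1 y hy]; exact hN y hy h)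
  rw [hc]
  refine ⟨_, _, .seq _ _ _ _ _ _ _ hx1 (.seq _ _ _ _ _ _ _ hx2 (.assign _ _ _)), ?_, ?_, ?_⟩
  · simp only [hcost, RamExpr.cost, Polynomial.eval_add, Polynomial.eval_ofNat]
    omega
  -- The second operand is computed from register `t + 1` on and leaves the first one intact.
  · have h3 : s2.reg t = e.val s := by rw [ha2.2.2 t ht (by omega), hv1]
    have h4 : f.val s1 = f.val s := f.val_congr hw ha1.2.1 ha1.1
    simp [hop, RamExpr.val, hv2, hval, h3, h4]
  · exact (ha1.trans (ha2.mono (fun _ h => h) (by omega))).trans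
      (agree_setReg _ (fun h => by have := hS _ h; omega) (by omega))

theorem compiles (e : HExpr) : ∀ {S : List ℕ} {t : ℕ}, (∀ x ∈ S, x < 100) → 100 ≤ t →
    e.wf S = true → Compiles S t e := by
  induction e with
  | lit k =>
    intro S t hS ht hw
    refine ⟨2, fun s N hN => ⟨_, _, .assign _ _ _, by simp [RamExpr.cost], by simp [RamExpr.val, val],
      agree_setReg _ (fun h => by have := hS _ h; omega) (by omega)⟩⟩
  | reg x =>
    intro S t hS ht hw
    refine ⟨2, fun s N hN => ⟨_, _, .assign _ _ _, by simp [RamExpr.cost], by simp [RamExpr.val, val],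
      agree_setReg _ (fun h => by have := hS _ h; omega) (by omega)⟩⟩
  | arr a e ih =>
    intro S t hS ht hw
    obtain ⟨p, hp⟩ := ih hS ht (by simpa [wf] using hw)
    refine ⟨p + 3, fun s N hN => ?_⟩
    obtain ⟨s1, k1, hx1, hk1, hv1, ha1⟩ := hp s N hN
    refine ⟨_, _, .seq _ _ _ _ _ _ _ hx1 (.assign _ _ _), ?_, ?_,
      ha1.trans (agree_setReg _ (fun h => by have := hS _ h; omega) (by omega))⟩
    · simpa [RamExpr.cost] using hk1
    · simp [RamExpr.val, val, hv1, ha1.1]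
  | add e f ih1 ih2 =>
    intro S t hS ht hw
    simp only [wf, Bool.and_eq_true] at hw
    exact compiles_binary hS ht .add (· + ·) (fun _ _ => rfl) (fun _ _ _ => rfl) rfl
      (fun _ => rfl) hw.2 (ih1 hS ht hw.1) (ih2 hS (by omega) hw.2)
  | sub e f ih1 ih2 =>
    intro S t hS ht hw
    simp only [wf, Bool.and_eq_true] at hw
    exact compiles_binary hS ht .sub (· - ·) (fun _ _ => rfl) (fun _ _ _ => rfl) rfl
      (fun _ => rfl) hw.2 (ih1 hS ht hw.1) (ih2 hS (by omega) hw.2)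
  | mul e y ih =>
    intro S t hS ht hw
    simp only [wf, Bool.and_eq_true, decide_eq_true_eq] at hw
    exact compiles_mul hS ht hw.1 (ih hS ht hw.2)
  | find x y e ih =>
    intro S t hS ht hw
    simp only [wf, Bool.and_eq_true, decide_eq_true_eq] at hw
    exact compiles_find hS ht hw.1 hw.2 (ih (fun z hz => by
      rw [List.mem_cons] at hz
      rcases hz with rfl | hz
      · exact hw.1.2.1
      · exact hS z hz) (by omega) hw.2)

end HExpr

/-! ### Triples with hidden polynomial time bounds -/

/-- The registers in use for variables of programs. -/
def progVars : List ℕ := List.range 10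

/-- The part of the state that programs are specified by. -/
def RamState.view (s : RamState) : RamState where
  reg x := if x < 10 then s.reg x else 0
  arr := s.arr

theorem HExpr.val_view {e : HExpr} (hw : e.wf progVars = true) (s : RamState) :
    e.val s.view = e.val s :=
  e.val_congr hw (fun x hx => by
    simp only [progVars, List.mem_range] at hx
    simp [RamState.view, hx]) rfl

/-- The registers that serve as bounds of searches are at most `N`. -/
def RamState.Bounded (N : ℕ) (s : RamState) : Prop := ∀ y < 3, s.reg y ≤ N

/-- Total correctness within a number of steps that is polynomial in the size. -/
def Triple {α : Type*} (size : α → ℕ) (Pre : α → RamState → Prop) (P : RamCmd)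
    (Post : α → RamState → Prop) : Prop :=
  ∃ p : Polynomial ℕ, ∀ a s, Pre a s.view →
    ∃ s' k, Exec P s s' k ∧ k ≤ p.eval (size a) ∧ Post a s'.view

namespace RamCmd

def set (x : ℕ) (e : HExpr) : RamCmd := .seq (e.compile 100) (.assign x (.reg 100))

def put (a : ℕ) (i e : HExpr) : RamCmd :=
  .seq (i.compile 100) (.seq (e.compile 101) (.store a (.reg 100) (.reg 101)))

def whileDo (e : HExpr) (P : RamCmd) : RamCmd :=
  .seq (e.compile 100) (.loop (.reg 100) (.seq P (e.compile 100)))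

end RamCmd

section Rules

variable {α : Type*} {size : α → ℕ}

theorem lt_of_mem_progVars {x : ℕ} (h : x ∈ progVars) : x < 10 := by
  simpa [progVars] using h

theorem HExpr.compiles_progVars {e : HExpr} (hw : e.wf progVars = true) {t : ℕ} (ht : 100 ≤ t) :
    ∃ p : Polynomial ℕ, ∀ s N, s.view.Bounded N →
      ∃ s' k, Exec (e.compile t) s s' k ∧ k ≤ p.eval N ∧ s'.reg t = e.val s.view ∧
        s'.view = s.view ∧ ∀ x, 100 ≤ x → x < t → s'.reg x = s.reg x := by
  obtain ⟨p, hp⟩ := e.compiles (fun x hx => (lt_of_mem_progVars hx).trans (by norm_num)) ht hw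
  refine ⟨p, fun s N hN => ?_⟩
  obtain ⟨s', k, hx, hk, hv, ha⟩ := hp s N (fun y hy h3 => by
    have := hN y h3
    simpa [RamState.view, lt_of_mem_progVars hy] using this)
  refine ⟨s', k, hx, hk, by rw [hv, val_view hw], ?_, ha.2.2⟩
  ext x
  · simp only [RamState.view]
    split_ifs with h
    · exact ha.2.1 x (by simpa [progVars] using h)
    · rfl
  · simp [RamState.view, ha.1]

theorem Triple.set {Pre Post : α → RamState → Prop} {x : ℕ} {e : HExpr}
    (hw : e.wf progVars = true) (hx : x < 10)
    (h : ∀ a s, Pre a s → s.Bounded (size a) ∧ Post a (s.setReg x (e.val s))) :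
    Triple size Pre (.set x e) Post := by
  obtain ⟨p, hp⟩ := e.compiles_progVars hw le_rfl
  refine ⟨p + 2, fun a s hs => ?_⟩
  obtain ⟨hb, hpost⟩ := h a _ hs
  obtain ⟨s', k, hx', hk, hv, hview, -⟩ := hp s _ hb
  refine ⟨_, _, .seq _ _ _ _ _ _ _ hx' (.assign _ _ _), by simpa [RamExpr.cost] using hk, ?_⟩
  have : (s'.setReg x (RamExpr.val s' (.reg 100))).view = s.view.setReg x (e.val s.view) := by
    rw [← hv, ← hview]
    ext z
    · by_cases hz : z = x
      · subst hz
        simp [RamState.view, hx, RamExpr.val]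
      · simp [RamState.view, hz]
    · simp [RamState.view]
  rw [this]
  exact hpost

theorem Triple.put {Pre Post : α → RamState → Prop} {b : ℕ} {i e : HExpr}
    (hi : i.wf progVars = true) (he : e.wf progVars = true)
    (h : ∀ a s, Pre a s → s.Bounded (size a) ∧ Post a (s.setArr b (i.val s) (e.val s))) :
    Triple size Pre (.put b i e) Post := by
  obtain ⟨p, hp⟩ := i.compiles_progVars hi le_rfl
  obtain ⟨q, hq⟩ := e.compiles_progVars he (t := 101) (by norm_num)
  refine ⟨p + q + 3, fun a s hs => ?_⟩
  obtain ⟨hb, hpost⟩ := h a _ hs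
  obtain ⟨s1, k1, hx1, hk1, hv1, hview1, -⟩ := hp s _ hb
  obtain ⟨s2, k2, hx2, hk2, hv2, hview2, ht⟩ := hq s1 _ (hview1 ▸ hb)
  refine ⟨_, _, .seq _ _ _ _ _ _ _ hx1 (.seq _ _ _ _ _ _ _ hx2 (.store _ _ _ _)), ?_, ?_⟩
  · simp only [RamExpr.cost, Polynomial.eval_add, Polynomial.eval_ofNat]
    omega
  · have h1 : s2.reg 100 = i.val s.view := by rw [ht 100 le_rfl (by norm_num), hv1]
    have h2 : s2.reg 101 = e.val s.view := by rw [hv2, hview1]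
    have : (s2.setArr b (RamExpr.val s2 (.reg 100)) (RamExpr.val s2 (.reg 101))).view =
        s.view.setArr b (i.val s.view) (e.val s.view) := by
      simp only [RamExpr.val, h1, h2]
      rw [hview1] at hview2
      generalize i.val s.view = i'
      generalize e.val s.view = e'
      rw [← hview2]
      rfl
    rw [this]
    exact hpost

theorem Triple.seq {Pre Mid Post : α → RamState → Prop} {P Q : RamCmd}
    (h1 : Triple size Pre P Mid) (h2 : Triple size Mid Q Post) :
    Triple size Pre (.seq P Q) Post := by
  obtain ⟨p, hp⟩ := h1
  obtain ⟨q, hq⟩ := h2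
  refine ⟨p + q, fun a s hs => ?_⟩
  obtain ⟨s1, k1, hx1, hk1, hs1⟩ := hp a s hs
  obtain ⟨s2, k2, hx2, hk2, hs2⟩ := hq a s1 hs1
  refine ⟨s2, _, .seq _ _ _ _ _ _ _ hx1 hx2, ?_, hs2⟩
  rw [Polynomial.eval_add]
  omega

/-- The parameter may be chosen anew depending on the state, as long as it is not larger;
polynomials over `ℕ` are monotone. -/
theorem Triple.conseq {β : Type*} {size' : β → ℕ} {Pre Post : α → RamState → Prop}
    {Pre' Post' : β → RamState → Prop} {P : RamCmd} (h : Triple size Pre P Post)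
    (h' : ∀ b s, Pre' b s → ∃ a, size a ≤ size' b ∧ Pre a s ∧ ∀ s', Post a s' → Post' b s') :
    Triple size' Pre' P Post' := by
  obtain ⟨p, hp⟩ := h
  refine ⟨p, fun b s hs => ?_⟩
  obtain ⟨a, ha, hpre, hpost⟩ := h' b _ hs
  obtain ⟨s', k, hx, hk, hs'⟩ := hp a s hpre
  exact ⟨s', k, hx, hk.trans (eval_le_eval_of_le p ha), hpost _ hs'⟩

/-- The measure bounds the number of passes. Pairing the parameter with the value of the measure
lets the body refer to that value, while the size ignores it, so one polynomial serves all passes.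
-/
theorem Triple.whileDo {I : α → RamState → Prop} {e : HExpr} {P : RamCmd}
    (μ : α → RamState → ℕ) (q : Polynomial ℕ) (hw : e.wf progVars = true)
    (hμ : ∀ a s, I a s → s.Bounded (size a) ∧ μ a s ≤ q.eval (size a))
    (hP : Triple (fun b : α × ℕ => size b.1)
      (fun b s => I b.1 s ∧ e.val s ≠ 0 ∧ μ b.1 s = b.2) P
      (fun b s => I b.1 s ∧ μ b.1 s < b.2)) :
    Triple size I (.whileDo e P) (fun a s => I a s ∧ e.val s = 0) := by
  obtain ⟨p, hp⟩ := e.compiles_progVars hw le_rfl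
  obtain ⟨p', hp'⟩ := hP
  refine ⟨q * (p + p' + 2) + p + 2, fun a s hs => ?_⟩
  have hloop : ∀ (j : ℕ) (s1 : RamState), μ a s1.view ≤ j → I a s1.view →
      s1.reg 100 = e.val s1.view →
      ∃ s' k, Exec (.loop (.reg 100) (.seq P (e.compile 100))) s1 s' k ∧
        k ≤ j * (p.eval (size a) + p'.eval (size a) + 2) + 2 ∧ I a s'.view ∧
        e.val s'.view = 0 := by
    intro j
    induction j with
    | zero =>
      intro s1 hj hI hv
      by_cases h0 : e.val s1.view = 0
      · exact ⟨s1, _, .loopDone _ _ _ (by simp [RamExpr.val, hv, h0]), by simp [RamExpr.cost],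
          hI, h0⟩
      -- With measure 0 the test must fail, as the body could not decrease the measure.
      · obtain ⟨s2, k2, -, -, hs2⟩ := hp' (a, μ a s1.view) s1 ⟨hI, h0, rfl⟩
        have := hs2.2
        simp only at this
        omega
    | succ j ih =>
      intro s1 hj hI hv
      by_cases h0 : e.val s1.view = 0
      · exact ⟨s1, _, .loopDone _ _ _ (by simp [RamExpr.val, hv, h0]), by simp [RamExpr.cost],
          hI, h0⟩
      · obtain ⟨s2, k2, hx2, hk2, hI2, hμ2⟩ := hp' (a, μ a s1.view) s1 ⟨hI, h0, rfl⟩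
        simp only at hk2 hI2 hμ2
        obtain ⟨s3, k3, hx3, hk3, hv3, hview3, -⟩ := hp s2 _ (hμ a _ hI2).1
        obtain ⟨s4, k4, hx4, hk4, hI4, h4⟩ := ih s3 (by rw [hview3]; omega) (hview3 ▸ hI2)
          (by rw [hv3, hview3])
        refine ⟨s4, _, .loopStep _ _ _ _ _ _ _ (by simpa [RamExpr.val, hv] using h0)
          (.seq _ _ _ _ _ _ _ hx2 hx3) hx4, ?_, hI4, h4⟩
        simp only [RamExpr.cost]
        rw [Nat.add_mul]
        omega
  obtain ⟨hb, hq⟩ := hμ a _ hs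
  obtain ⟨s1, k1, hx1, hk1, hv1, hview1, -⟩ := hp s _ hb
  obtain ⟨s2, k2, hx2, hk2, hs2⟩ := hloop _ s1 (hview1 ▸ hq) (hview1 ▸ hs) (by rw [hv1, hview1])
  refine ⟨s2, _, .seq _ _ _ _ _ _ _ hx1 hx2, ?_, hs2⟩
  simp only [Polynomial.eval_add, Polynomial.eval_mul, Polynomial.eval_ofNat]
  omega

end Rules

/-! ### Boolean expressions -/

namespace HExpr

/-- The expression is true in the state. -/
def Holds (e : HExpr) (s : RamState) : Prop := e.val s ≠ 0

def neg (e : HExpr) : HExpr := sub (lit 1) e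
def le (e f : HExpr) : HExpr := neg (sub e f)
def or (e f : HExpr) : HExpr := add e f
def and (e f : HExpr) : HExpr := neg (or (neg e) (neg f))
def eq (e f : HExpr) : HExpr := and (le e f) (le f e)
-- An unsuccessful search returns the bound itself, so the difference vanishes exactly on failure.
def ex (x y : ℕ) (e : HExpr) : HExpr := sub (reg y) (find x y e)
def all (x y : ℕ) (e : HExpr) : HExpr := neg (ex x y (neg e))

variable {e f : HExpr} {s : RamState}

theorem val_eq_zero_iff : e.val s = 0 ↔ ¬ e.Holds s := not_not.symm

@[simp] theorem holds_neg : (neg e).Holds s ↔ ¬ e.Holds s := by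
  simp only [Holds, neg, val]; omega

@[simp] theorem holds_le : (le e f).Holds s ↔ e.val s ≤ f.val s := by
  simp only [le, holds_neg]
  simp only [Holds, val]; omega

@[simp] theorem holds_or : (or e f).Holds s ↔ e.Holds s ∨ f.Holds s := by
  simp only [Holds, or, val]; omega

@[simp] theorem holds_and : (and e f).Holds s ↔ e.Holds s ∧ f.Holds s := by
  simp only [and, holds_neg, holds_or]; tauto

@[simp] theorem holds_eq : (eq e f).Holds s ↔ e.val s = f.val s := by
  simp only [eq, holds_and, holds_le]; omega

theorem holds_ex {x y N : ℕ} (hy : s.reg y = N) :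
    (ex x y e).Holds s ↔ ∃ j : Fin N, e.Holds (s.setReg x j) := by
  simp only [Holds, ex, val]
  rw [Nat.sub_ne_zero_iff_lt, least_lt_iff, hy]
  exact ⟨fun ⟨j, hj, h⟩ => ⟨⟨j, hj⟩, h⟩, fun ⟨j, h⟩ => ⟨j, j.2, h⟩⟩

theorem holds_all {x y N : ℕ} (hy : s.reg y = N) :
    (all x y e).Holds s ↔ ∀ j : Fin N, e.Holds (s.setReg x j) := by
  simp [all, holds_ex hy]

/-- A successful search. -/
theorem exists_val_find {x y N : ℕ} (hy : s.reg y = N) (h : ∃ j : Fin N, e.Holds (s.setReg x j)) :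
    ∃ j : Fin N, (find x y e).val s = j ∧ e.Holds (s.setReg x j) := by
  obtain ⟨j, hj⟩ := h
  have h1 : (find x y e).val s < N := by
    simp only [val, hy]
    exact least_lt_iff.2 ⟨j, j.2, hj⟩
  refine ⟨⟨_, h1⟩, rfl, ?_⟩
  have h2 := h1
  simp only [val, hy] at h2
  have h3 := least_spec h2
  simpa only [Holds, val, hy] using h3

@[simp] theorem val_lit (k : ℕ) : (lit k).val s = k := rfl
@[simp] theorem val_reg (x : ℕ) : (reg x).val s = s.reg x := rfl
@[simp] theorem val_arr (a : ℕ) : (arr a e).val s = s.arr a (e.val s) := rfl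
@[simp] theorem val_add : (add e f).val s = e.val s + f.val s := rfl
@[simp] theorem val_sub : (sub e f).val s = e.val s - f.val s := rfl
@[simp] theorem val_mul (y : ℕ) : (mul e y).val s = e.val s * s.reg y := rfl

theorem holds_arr {a : ℕ} : (arr a e).Holds s ↔ s.arr a (e.val s) ≠ 0 := Iff.rfl

/-- The index of the entry `(k, u, v)` in a cubic table of size `reg y`. -/
def idx (y : ℕ) (k u v : HExpr) : HExpr := add (mul (add (mul k y) u) y) v

@[simp] theorem val_idx {y : ℕ} {k u v : HExpr} :
    (idx y k u v).val s = (k.val s * s.reg y + u.val s) * s.reg y + v.val s := rfl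

end HExpr

/-! ### All distances of a graph -/

theorem mul_add_inj {N a b a' b' : ℕ} (hb : b < N) (hb' : b' < N)
    (h : a * N + b = a' * N + b') : a = a' ∧ b = b' := by
  have ha : a = a' := by
    have := congrArg (· / N) h
    simp only [add_comm (_ * N)] at this
    rwa [Nat.add_mul_div_right _ _ (by omega), Nat.add_mul_div_right _ _ (by omega),
      Nat.div_eq_of_lt hb, Nat.div_eq_of_lt hb', zero_add, zero_add] at this
  subst ha
  exact ⟨rfl, by omega⟩

/-- The recursion that fills layer `k + 1` of the distance table from layer `k`. -/
theorem dist_le_succ_iff {V : Type*} {H : SimpleGraph V} (hH : H.Connected) (u v : V) (k : ℕ) :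
    H.dist u v ≤ k + 1 ↔ H.dist u v ≤ k ∨ ∃ w, H.dist u w ≤ k ∧ H.Adj w v := by
  constructor
  · intro h
    rcases Nat.lt_or_ge k (H.dist u v) with h1 | h1
    · obtain ⟨p, hp⟩ := hH.exists_walk_length_eq_dist v u
      rw [SimpleGraph.dist_comm] at hp
      cases p with
      | nil =>
        simp only [SimpleGraph.Walk.length_nil] at hp
        omega
      | cons hadj q =>
        rename_i w
        simp only [SimpleGraph.Walk.length_cons] at hp
        have := SimpleGraph.dist_le q
        exact Or.inr ⟨w, by rw [SimpleGraph.dist_comm]; omega, hadj.symm⟩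
    · exact Or.inl h1
  · rintro (h | ⟨w, h, hadj⟩)
    · omega
    · have h1 : H.dist u v ≤ H.dist u w + H.dist w v := hH.dist_triangle
      have h2 : H.dist w v = 1 := SimpleGraph.dist_eq_one_iff_adj.2 hadj
      omega

open HExpr RamCmd in
/-- From the adjacency matrix in array `a` of a graph on `reg y` vertices, the truth values of
`dist u v ≤ k` are written into the cubic table in array `d`. The tests decode the index `reg 9`
into `k`, `u`, `v`. -/
def distProg (a d y : ℕ) : RamCmd :=
  -- The loop ends at the first index that encodes no triple, so the size of the table is never
  -- computed.
  .seq (set 9 (lit 0)) (whileDo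
    (ex 10 y (ex 11 y (ex 12 y (eq (idx y (reg 10) (reg 11) (reg 12)) (reg 9)))))
    (.seq (set 6 (find 10 y (ex 11 y (ex 12 y (eq (idx y (reg 10) (reg 11) (reg 12)) (reg 9))))))
    (.seq (set 7 (find 11 y (ex 12 y (eq (idx y (reg 6) (reg 11) (reg 12)) (reg 9)))))
    (.seq (set 8 (find 12 y (eq (idx y (reg 6) (reg 7) (reg 12)) (reg 9))))
    (.seq (put d (reg 9)
      (or (and (eq (reg 6) (lit 0)) (eq (reg 7) (reg 8)))
        (and (neg (eq (reg 6) (lit 0)))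
          (or (arr d (idx y (sub (reg 6) (lit 1)) (reg 7) (reg 8)))
            (ex 10 y (and (arr d (idx y (sub (reg 6) (lit 1)) (reg 7) (reg 10)))
              (arr a (add (mul (reg 10) y) (reg 8)))))))))
      (set 9 (add (reg 9) (lit 1))))))))

/-- A connected graph together with an initial state and a bound on the size. -/
structure DistInstance where
  N : ℕ
  graph : SimpleGraph (Fin N)
  conn : graph.Connected
  init : RamState
  bound : ℕ

/-- Array `a` of the initial state is the adjacency matrix of the graph. -/
def DistInstance.Encodes (D : DistInstance) (a y : ℕ) : Prop :=
  D.init.reg y = D.N ∧ D.init.Bounded D.bound ∧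
    ∀ u v : Fin D.N, D.init.arr a (u * D.N + v) ≠ 0 ↔ D.graph.Adj u v

/-- The state differs from the initial one in the registers from `6` on and in array `d` only, and
the first `c` entries of the cubic table are correct. -/
def DistInstance.Inv (D : DistInstance) (d c : ℕ) (s : RamState) : Prop :=
  (∀ x < 6, s.reg x = D.init.reg x) ∧ (∀ b ≠ d, s.arr b = D.init.arr b) ∧
    ∀ k u v : Fin D.N, (k * D.N + u) * D.N + v < c →
      (s.arr d ((k * D.N + u) * D.N + v) ≠ 0 ↔ D.graph.dist u v ≤ k)

section DistProg

variable {D : DistInstance} {a d y c : ℕ} {s : RamState}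

theorem DistInstance.Inv.setReg (h : D.Inv d c s) {x k : ℕ} (hx : 6 ≤ x) :
    D.Inv d c (s.setReg x k) :=
  ⟨fun z hz => by simpa [show z ≠ x by omega] using h.1 z hz, h.2.1, h.2.2⟩

theorem DistInstance.Inv.bounded (h : D.Inv d c s) (hE : D.Encodes a y) : s.Bounded D.bound :=
  fun z hz => by rw [h.1 z (by omega)]; exact hE.2.1 z hz

theorem DistInstance.Inv.setArr (h : D.Inv d c s) {k u v : Fin D.N}
    (hc : (k * D.N + u) * D.N + v = c) {b : ℕ} (hb : b ≠ 0 ↔ D.graph.dist u v ≤ k) :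
    D.Inv d (c + 1) (s.setArr d c b) := by
  refine ⟨h.1, fun b' hb' => ?_, fun k' u' v' hlt => ?_⟩
  · rw [← h.2.1 b' hb']
    funext i
    simp [hb']
  · by_cases he : (k' * D.N + u' : ℕ) * D.N + v' = c
    · obtain ⟨h1, h2⟩ := mul_add_inj v.2 v'.2 (hc.trans he.symm)
      obtain ⟨h3, h4⟩ := mul_add_inj u.2 u'.2 h1
      rw [← Fin.ext h2, ← Fin.ext h3, ← Fin.ext h4, hc]
      simpa using hb
    · simpa [he] using h.2.2 k' u' v' (by omega)

theorem DistInstance.exists_index {c : ℕ} (hc : c < D.N * D.N * D.N) :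
    ∃ k u v : Fin D.N, (k * D.N + u : ℕ) * D.N + v = c := by
  have hN : 0 < D.N := by
    rcases Nat.eq_zero_or_pos D.N with h | h
    · simp [h] at hc
    · exact h
  refine ⟨⟨c / D.N / D.N, ?_⟩, ⟨c / D.N % D.N, Nat.mod_lt _ hN⟩, ⟨c % D.N, Nat.mod_lt _ hN⟩, ?_⟩
  · rw [Nat.div_lt_iff_lt_mul hN, Nat.div_lt_iff_lt_mul hN]
    exact hc
  · simp only [mul_comm _ D.N, Nat.div_add_mod]

theorem DistInstance.index_lt (k u v : Fin D.N) :
    (k * D.N + u : ℕ) * D.N + v < D.N * D.N * D.N := by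
  have h1 : (k * D.N + u : ℕ) + 1 ≤ D.N * D.N := by
    have h2 := Nat.mul_le_mul_right D.N k.2
    rw [Nat.succ_mul] at h2
    have := u.2
    omega
  have h2 := Nat.mul_le_mul_right D.N h1
  rw [Nat.succ_mul] at h2
  have := v.2
  omega

theorem DistInstance.Inv.entry (h : D.Inv d c s) (hE : D.Encodes a y) (hd : a ≠ d) {k u v : Fin D.N}
    (hc : (k * D.N + u : ℕ) * D.N + v = c) :
    ((k = (0 : ℕ) ∧ (u : ℕ) = v) ∨ ((k : ℕ) ≠ 0 ∧
      (s.arr d (((k - 1 : ℕ) * D.N + u) * D.N + v) ≠ 0 ∨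
        ∃ w : Fin D.N, s.arr d (((k - 1 : ℕ) * D.N + u) * D.N + w) ≠ 0 ∧
          s.arr a (w * D.N + v) ≠ 0))) ↔ D.graph.dist u v ≤ k := by
  obtain ⟨k, hk⟩ := k
  cases k with
  | zero =>
    simp only [ne_eq, not_true_eq_false, false_and, or_false, true_and, nonpos_iff_eq_zero]
    rw [D.conn.dist_eq_zero_iff, Fin.ext_iff]
  | succ k =>
    -- Layer `k` precedes layer `k + 1` in the table and is already correct.
    have hprev : ∀ w : Fin D.N,
        s.arr d ((k * D.N + u) * D.N + w) ≠ 0 ↔ D.graph.dist u w ≤ k := by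
      intro w
      refine h.2.2 ⟨k, by omega⟩ u w ?_
      simp only [← hc]
      have h1 : (k * D.N + u : ℕ) + 1 ≤ (k + 1) * D.N + u := by
        rw [Nat.add_mul]
        have := u.2
        omega
      have h2 := Nat.mul_le_mul_right D.N h1
      rw [Nat.succ_mul] at h2
      have := w.2
      omega
    simp only [Nat.add_sub_cancel, hprev, h.2.1 a hd, hE.2.2]
    rw [dist_le_succ_iff D.conn]
    simp

theorem distProg_spec (a d y : ℕ) (hy : y < 3) (hd : a ≠ d) :
    Triple DistInstance.bound (fun D s => D.Encodes a y ∧ s = D.init) (distProg a d y)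
      (fun D s => D.Inv d (D.N * D.N * D.N) s) := by
  refine Triple.seq (Mid := fun D s => D.Encodes a y ∧ D.Inv d (s.reg 9) s) ?_ ?_
  · refine Triple.set (by rfl) (by norm_num) ?_
    rintro D s ⟨hE, rfl⟩
    exact ⟨hE.2.1, hE, ⟨fun x hx => by simp [show x ≠ 9 by omega], by simp, by simp⟩⟩
  · refine Triple.conseq (Triple.whileDo (size := DistInstance.bound)
      (I := fun D s => D.Encodes a y ∧ D.Inv d (s.reg 9) s)
      (fun (D : DistInstance) s => D.N * D.N * D.N - s.reg 9)
      (Polynomial.X * Polynomial.X * Polynomial.X) (by interval_cases y <;> rfl) ?_ ?_) ?_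
    · rintro D s ⟨hE, hI⟩
      refine ⟨hI.bounded hE, (Nat.sub_le _ _).trans ?_⟩
      have : D.N ≤ D.bound := hE.1 ▸ hE.2.1 y hy
      simp only [Polynomial.eval_mul, Polynomial.eval_X]
      gcongr
    -- The coordinates are found one at a time; each intermediate assertion fixes those already
    -- found and keeps the existence of the rest.
    · refine Triple.seq (Mid := fun b s => b.1.Encodes a y ∧ b.1.Inv d (s.reg 9) s ∧
        b.1.N * b.1.N * b.1.N - s.reg 9 = b.2 ∧ ∃ k u v : Fin b.1.N,
          (k * b.1.N + u : ℕ) * b.1.N + v = s.reg 9 ∧ s.reg 6 = k) ?_ ?_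
      · refine Triple.set (by interval_cases y <;> rfl) (by norm_num) ?_
        rintro ⟨D, j⟩ s ⟨⟨hE, hI⟩, he, hμ⟩
        have hsy : s.reg y = D.N := by rw [hI.1 y (by omega), hE.1]
        obtain ⟨k, hk, hk'⟩ := HExpr.exists_val_find hsy ((HExpr.holds_ex hsy).1 he)
        rw [HExpr.holds_ex (N := D.N) (by simp [hsy, show y ≠ 10 by omega])] at hk'
        obtain ⟨u, hk'⟩ := hk'
        rw [HExpr.holds_ex (N := D.N) (by simp [hsy, show y ≠ 10 by omega, show y ≠ 11 by omega])]
          at hk'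
        obtain ⟨v, hk'⟩ := hk'
        simp [hsy, show y ≠ 10 by omega, show y ≠ 11 by omega, show y ≠ 12 by omega] at hk'
        exact ⟨hI.bounded hE, hE, hI.setReg (by norm_num), hμ, k, u, v, hk', by simp [hk]⟩
      refine Triple.seq (Mid := fun b s => b.1.Encodes a y ∧ b.1.Inv d (s.reg 9) s ∧
        b.1.N * b.1.N * b.1.N - s.reg 9 = b.2 ∧ ∃ k u v : Fin b.1.N,
          (k * b.1.N + u : ℕ) * b.1.N + v = s.reg 9 ∧ s.reg 6 = k ∧ s.reg 7 = u) ?_ ?_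
      · refine Triple.set (by interval_cases y <;> rfl) (by norm_num) ?_
        rintro ⟨D, j⟩ s ⟨hE, hI, hμ, k, u, v, hc, h6⟩
        have hsy : s.reg y = D.N := by rw [hI.1 y (by omega), hE.1]
        obtain ⟨u', hu, hu'⟩ := HExpr.exists_val_find (x := 11) (e := .ex 12 y (.eq
          (.idx y (.reg 6) (.reg 11) (.reg 12)) (.reg 9))) hsy ⟨u, by
            rw [HExpr.holds_ex (N := D.N) (by simp [hsy, show y ≠ 11 by omega])]
            exact ⟨v, by simp [hsy, show y ≠ 11 by omega, show y ≠ 12 by omega, h6, hc]⟩⟩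
        rw [HExpr.holds_ex (N := D.N) (by simp [hsy, show y ≠ 11 by omega])] at hu'
        obtain ⟨v', hu'⟩ := hu'
        simp [hsy, show y ≠ 11 by omega, show y ≠ 12 by omega, h6] at hu'
        exact ⟨hI.bounded hE, hE, hI.setReg (by norm_num), hμ, k, u', v', hu', by simp [h6],
          by simp [hu]⟩
      refine Triple.seq (Mid := fun b s => b.1.Encodes a y ∧ b.1.Inv d (s.reg 9) s ∧
        b.1.N * b.1.N * b.1.N - s.reg 9 = b.2 ∧ ∃ k u v : Fin b.1.N,
          (k * b.1.N + u : ℕ) * b.1.N + v = s.reg 9 ∧ s.reg 6 = k ∧ s.reg 7 = u ∧ s.reg 8 = v)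
          ?_ ?_
      · refine Triple.set (by interval_cases y <;> rfl) (by norm_num) ?_
        rintro ⟨D, j⟩ s ⟨hE, hI, hμ, k, u, v, hc, h6, h7⟩
        have hsy : s.reg y = D.N := by rw [hI.1 y (by omega), hE.1]
        obtain ⟨v', hv, hv'⟩ := HExpr.exists_val_find (x := 12) (e := .eq
          (.idx y (.reg 6) (.reg 7) (.reg 12)) (.reg 9)) hsy
          ⟨v, by simp [hsy, show y ≠ 12 by omega, h6, h7, hc]⟩
        simp [hsy, show y ≠ 12 by omega, h6, h7] at hv'
        exact ⟨hI.bounded hE, hE, hI.setReg (by norm_num), hμ, k, u, v', hv', by simp [h6],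
          by simp [h7], by simp [hv]⟩
      refine Triple.seq (Mid := fun b s => b.1.Encodes a y ∧ b.1.Inv d (s.reg 9 + 1) s ∧
        b.1.N * b.1.N * b.1.N - s.reg 9 = b.2 ∧ s.reg 9 < b.1.N * b.1.N * b.1.N) ?_ ?_
      · refine Triple.put (by interval_cases y <;> rfl) (by interval_cases y <;> rfl) ?_
        rintro ⟨D, j⟩ s ⟨hE, hI, hμ, k, u, v, hc, h6, h7, h8⟩
        have hsy : s.reg y = D.N := by rw [hI.1 y (by omega), hE.1]
        refine ⟨hI.bounded hE, hE, hI.setArr hc ?_, hμ, hc ▸ DistInstance.index_lt k u v⟩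
        rw [← hI.entry hE hd hc, ← HExpr.Holds]
        simp only [HExpr.holds_or, HExpr.holds_and, HExpr.holds_eq, HExpr.holds_neg,
          HExpr.holds_ex hsy, HExpr.holds_arr]
        simp [hsy, show y ≠ 10 by omega, h6, h7, h8]
      · refine Triple.set (by rfl) (by norm_num) ?_
        rintro ⟨D, j⟩ s ⟨hE, hI, hμ, hlt⟩
        refine ⟨hI.bounded hE, ⟨hE, hI.setReg (by norm_num)⟩, ?_⟩
        simp only at hμ hlt
        simp only [RamState.setReg_reg, if_true, HExpr.val_add, HExpr.val_reg, HExpr.val_lit]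
        omega
    · rintro D s ⟨hE, hI⟩
      refine ⟨D, le_rfl, ⟨hE, hI⟩, ?_⟩
      rintro s' ⟨⟨hE, hI⟩, he⟩
      refine ⟨hI.1, hI.2.1, fun k u v _ => hI.2.2 k u v ?_⟩
      -- If an entry had not been reached, the counter would still encode a triple and the test
      -- would succeed.
      by_contra! hge
      have hsy : s'.reg y = D.N := by rw [hI.1 y (by omega), hE.1]
      obtain ⟨k', u', v', h'⟩ := DistInstance.exists_index (hge.trans_lt (DistInstance.index_lt k u v))
      rw [HExpr.val_eq_zero_iff] at he
      refine he ((HExpr.holds_ex hsy).2 ⟨k', ?_⟩)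
      rw [HExpr.holds_ex (N := D.N) (by simp [hsy, show y ≠ 10 by omega])]
      refine ⟨u', ?_⟩
      rw [HExpr.holds_ex (N := D.N) (by simp [hsy, show y ≠ 10 by omega, show y ≠ 11 by omega])]
      exact ⟨v', by
        simp [hsy, show y ≠ 10 by omega, show y ≠ 11 by omega, show y ≠ 12 by omega, h']⟩

end DistProg

/-- Thus layers `k < n` suffice, and a distance can be found by a search bounded by `n`. -/
theorem dist_lt_card {n : ℕ} {H : SimpleGraph (Fin n)} (hH : H.Connected) (u v : Fin n) :
    H.dist u v < n := by
  obtain ⟨p, hp, hl⟩ := hH.exists_path_of_dist u v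
  have := hp.length_lt
  rw [Fintype.card_fin] at this
  omega

/-! ### The state in the main part of the program -/

/-- The state holds a connected graph, a tree decomposition of it, and all distances in the graph
and in the tree. -/
structure Ctx {n m : ℕ} (G : SimpleGraph (Fin n)) (T : TreeDecomposition G (Fin m))
    (s : RamState) : Prop where
  conn : G.Connected
  reg_zero : s.reg 0 = n
  reg_one : s.reg 1 = m
  adj : ∀ i j : Fin m, s.arr 1 (i * m + j) ≠ 0 ↔ T.tree.Adj i j
  bag : ∀ (i : Fin m) (v : Fin n), s.arr 2 (i * n + v) ≠ 0 ↔ v ∈ T.bag i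
  distG : ∀ k u v : Fin n, s.arr 4 ((k * n + u) * n + v) ≠ 0 ↔ G.dist u v ≤ k
  distT : ∀ k i j : Fin m, s.arr 5 ((k * m + i) * m + j) ≠ 0 ↔ T.tree.dist i j ≤ k

namespace HExpr

/-- The distance of `e` and `f`, from the cubic table in array `d` for `reg y` vertices. -/
def dist (d y x : ℕ) (e f : HExpr) : HExpr := find x y (arr d (idx y (reg x) e f))

def distG (x : ℕ) (e f : HExpr) : HExpr := dist 4 0 x e f
def distT (x : ℕ) (e f : HExpr) : HExpr := dist 5 1 x e f

/-- Vertex `v` is in the bag `i`. -/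
def inBag (i v : HExpr) : HExpr := arr 2 (add (mul i 0) v)

/-- The nodes `i` and `j` are adjacent in the tree. -/
def adjT (i j : HExpr) : HExpr := arr 1 (add (mul i 1) j)

/-- The distance is the first layer with a nonzero entry. The operands must keep their values when
the search register changes. -/
theorem val_dist {n d y x : ℕ} {H : SimpleGraph (Fin n)} (hH : H.Connected) {e f : HExpr}
    {s : RamState} {u v : Fin n} (hy : s.reg y = n) (hyx : y ≠ x)
    (hd : ∀ k u v : Fin n, s.arr d ((k * n + u) * n + v) ≠ 0 ↔ H.dist u v ≤ k)
    (he : ∀ j, e.val (s.setReg x j) = u) (hf : ∀ j, f.val (s.setReg x j) = v) :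
    (dist d y x e f).val s = H.dist u v := by
  have hlt := dist_lt_card hH u v
  simp only [dist, val, hy]
  refine least_eq hlt.le (fun _ => ?_) (fun j hj => ?_)
  · have := (hd ⟨_, hlt⟩ u v).2 le_rfl
    simpa [hyx, hy, he, hf] using this
  · have := (hd ⟨j, by omega⟩ u v).not.2 (by simpa using hj)
    simpa [hyx, hy, he, hf] using this

end HExpr

section

variable {n m : ℕ} {G : SimpleGraph (Fin n)} {T : TreeDecomposition G (Fin m)} {s : RamState}

theorem Ctx.setReg (h : Ctx G T s) {x : ℕ} (k : ℕ) (hx : 2 ≤ x) : Ctx G T (s.setReg x k) :=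
  ⟨h.conn, by simpa [show (0 : ℕ) ≠ x by omega] using h.reg_zero,
    by simpa [show (1 : ℕ) ≠ x by omega] using h.reg_one, h.adj, h.bag, h.distG, h.distT⟩

theorem Ctx.setArr (h : Ctx G T s) (j k : ℕ) : Ctx G T (s.setArr 3 j k) :=
  ⟨h.conn, h.reg_zero, h.reg_one, by simpa using h.adj, by simpa using h.bag,
    by simpa using h.distG, by simpa using h.distT⟩

theorem Ctx.val_distG (h : Ctx G T s) {x : ℕ} (hx : 2 ≤ x) {e f : HExpr} (u v : Fin n)
    (he : ∀ j, e.val (s.setReg x j) = u) (hf : ∀ j, f.val (s.setReg x j) = v) :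
    (HExpr.distG x e f).val s = G.dist u v :=
  HExpr.val_dist h.conn h.reg_zero (by omega) h.distG he hf

theorem Ctx.val_distT (h : Ctx G T s) {x : ℕ} (hx : 2 ≤ x) {e f : HExpr} (u v : Fin m)
    (he : ∀ j, e.val (s.setReg x j) = u) (hf : ∀ j, f.val (s.setReg x j) = v) :
    (HExpr.distT x e f).val s = T.tree.dist u v :=
  HExpr.val_dist T.isTree.connected h.reg_one (by omega) h.distT he hf

theorem Ctx.holds_inBag (h : Ctx G T s) {e f : HExpr} (i : Fin m) (v : Fin n) (he : e.val s = i)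
    (hf : f.val s = v) : (HExpr.inBag e f).Holds s ↔ v ∈ T.bag i := by
  rw [HExpr.inBag, HExpr.holds_arr, ← h.bag]
  simp [he, hf, h.reg_zero]

theorem Ctx.holds_adjT (h : Ctx G T s) {e f : HExpr} (i j : Fin m) (he : e.val s = i)
    (hf : f.val s = j) : (HExpr.adjT e f).Holds s ↔ T.tree.Adj i j := by
  rw [HExpr.adjT, HExpr.holds_arr, ← h.adj]
  simp [he, hf, h.reg_one]

namespace HExpr

/-- The length of the decomposition. -/
def length : HExpr :=
  find 10 0 (all 11 1 (all 12 0 (all 13 0 (or (neg (and (inBag (reg 11) (reg 12))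
    (inBag (reg 11) (reg 13)))) (le (distG 14 (reg 12) (reg 13)) (reg 10))))))

end HExpr

theorem Ctx.val_length (h : Ctx G T s) : HExpr.length.val s = T.length := by
  have hbody : ∀ j : ℕ, (HExpr.all 11 1 (.all 12 0 (.all 13 0 (.or (.neg (.and
      (.inBag (.reg 11) (.reg 12)) (.inBag (.reg 11) (.reg 13))))
      (.le (.distG 14 (.reg 12) (.reg 13)) (.reg 10)))))).Holds (s.setReg 10 j) ↔
      T.length ≤ j := by
    intro j
    have h1 := h.setReg (x := 10) j (by norm_num)
    rw [T.length_le_iff, HExpr.holds_all h1.reg_one]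
    refine forall_congr' fun i => ?_
    have h2 := h1.setReg (x := 11) i (by norm_num)
    rw [HExpr.holds_all h2.reg_zero]
    have key : ∀ u : Fin n, (HExpr.all 13 0 (.or (.neg (.and
        (.inBag (.reg 11) (.reg 12)) (.inBag (.reg 11) (.reg 13))))
        (.le (.distG 14 (.reg 12) (.reg 13)) (.reg 10)))).Holds
        (((s.setReg 10 j).setReg 11 i).setReg 12 u) ↔
        ∀ v, u ∈ T.bag i ∧ v ∈ T.bag i → G.dist u v ≤ j := by
      intro u
      have h3 := h2.setReg (x := 12) u (by norm_num)
      rw [HExpr.holds_all h3.reg_zero]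
      refine forall_congr' fun v => ?_
      have h4 := h3.setReg (x := 13) v (by norm_num)
      rw [HExpr.holds_or, HExpr.holds_neg, HExpr.holds_and, HExpr.holds_le,
        h4.holds_inBag i u (by simp) (by simp), h4.holds_inBag i v (by simp) (by simp),
        h4.val_distG (by norm_num) u v (by simp) (by simp)]
      simp [imp_iff_not_or]
    simp only [key]
    exact ⟨fun H u hu v hv => H u v ⟨hu, hv⟩, fun H u v huv => H u huv.1 v huv.2⟩
  have hlt : T.length < n := by
    have hpos : 0 < n := Fin.pos (Classical.choice h.conn.nonempty)
    have : T.length ≤ n - 1 := (T.length_le_iff _).2 fun i u _ v _ => by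
      have := dist_lt_card h.conn u v
      omega
    omega
  simp only [HExpr.length, HExpr.val, h.reg_zero]
  refine least_eq hlt.le (fun _ => (hbody _).2 le_rfl) fun j hj => ?_
  rw [HExpr.val_eq_zero_iff]
  exact (hbody j).not.2 (by omega)

end

/-! ### Instances, calls of the procedure, and the states they pass through. -/

/-- A connected graph with a tree decomposition. -/
structure Instance where
  n : ℕ
  m : ℕ
  G : SimpleGraph (Fin n)
  T : TreeDecomposition G (Fin m)
  conn : G.Connected

def Instance.size (I : Instance) : ℕ := I.n + I.m

theorem Instance.m_pos (I : Instance) : 0 < I.m :=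
  Fin.pos (Classical.choice I.T.isTree.connected.nonempty)

/-- The data of a call of the procedure with parameter `g`, when the procedure may fail for all
smaller parameters. -/
structure Call extends Instance where
  r : Fin m
  o : Fin n
  mem : o ∈ T.bag r
  o_eq : (o : ℕ) = 0
  g : ℕ
  one_le : 1 ≤ g
  le_n : g ≤ n
  none_of_lt : ∀ g', 1 ≤ g' → g' < g → BurnGuess T r o g' none

/-- The fixed part of the state during a call. -/
structure Call.Base (C : Call) (s : RamState) : Prop where
  ctx : Ctx C.G C.T s
  reg_two : s.reg 2 ≤ C.size
  reg_three : s.reg 3 = C.g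
  reg_four : s.reg 4 = C.T.length
  reg_five : s.reg 5 = C.r

/-- The state after the activators `A` have been chosen. -/
structure Call.State (C : Call) (A : List (Fin C.n)) (s : RamState) : Prop where
  base : C.Base s
  out : ∀ (j : ℕ) (c : Fin C.n), A[j]? = some c → s.arr 3 j = c
  reach : Reach C.T C.r C.o C.g (s.reg 2) A (marked C.T C.g A)

namespace HExpr

/-- The vertex in register `z` is not marked. -/
def unmarked (z x : ℕ) : HExpr :=
  neg (ex x 2 (le (distG (x + 1) (reg z) (arr 3 (reg x)))
    (add (add (sub (add (reg 3) (reg 3)) (add (reg x) (lit 1))) (lit 1))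
      (add (add (reg 4) (reg 4)) (add (reg 4) (reg 4))))))

end HExpr

section

variable {C : Call} {A : List (Fin C.n)} {s : RamState}

theorem Call.Base.bounded (h : C.Base s) : s.Bounded C.size := by
  intro y hy
  interval_cases y
  · rw [h.ctx.reg_zero]; exact Nat.le_add_right _ _
  · rw [h.ctx.reg_one]; exact Nat.le_add_left _ _
  · exact h.reg_two

theorem Call.Base.setReg (h : C.Base s) {x : ℕ} (k : ℕ) (hx : 6 ≤ x) : C.Base (s.setReg x k) :=
  ⟨h.ctx.setReg k (by omega), by simpa [show (2 : ℕ) ≠ x by omega] using h.reg_two,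
    by simpa [show (3 : ℕ) ≠ x by omega] using h.reg_three,
    by simpa [show (4 : ℕ) ≠ x by omega] using h.reg_four,
    by simpa [show (5 : ℕ) ≠ x by omega] using h.reg_five⟩

theorem Call.State.setReg (h : C.State A s) {x : ℕ} (k : ℕ) (hx : 6 ≤ x) :
    C.State A (s.setReg x k) :=
  ⟨h.base.setReg k hx, h.out, by simpa [show (2 : ℕ) ≠ x by omega] using h.reach⟩

theorem Call.State.holds_unmarked (h : C.State A s) {z x : ℕ} (hx : 6 ≤ x) (hz : z < x)
    (u : Fin C.n) (hu : s.reg z = u) :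
    (HExpr.unmarked z x).Holds s ↔ u ∉ marked C.T C.g A := by
  rw [HExpr.unmarked, HExpr.holds_neg, not_iff_not, HExpr.holds_ex h.reach.length_eq.1.symm,
    marked, Set.mem_ofPred_eq]
  have key : ∀ j : Fin A.length, (HExpr.le (.distG (x + 1) (.reg z) (.arr 3 (.reg x)))
      (.add (.add (.sub (.add (.reg 3) (.reg 3)) (.add (.reg x) (.lit 1))) (.lit 1))
        (.add (.add (.reg 4) (.reg 4)) (.add (.reg 4) (.reg 4))))).Holds (s.setReg x j) ↔
      C.G.dist u A[j] ≤ (2 * C.g - (j + 1) + 1) + 4 * C.T.length := by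
    intro j
    have h1 := h.setReg (x := x) j hx
    rw [HExpr.holds_le, h1.base.ctx.val_distG (by omega) u A[j]
      (by simp [show z ≠ x by omega, show z ≠ x + 1 by omega, hu])
      (by simp [h.out j A[j] (by simp)])]
    simp only [HExpr.val_add, HExpr.val_sub, HExpr.val_reg, HExpr.val_lit, h1.base.reg_three,
      h1.base.reg_four, RamState.setReg_reg, if_true]
    rw [show C.g + C.g = 2 * C.g by ring, show C.T.length + C.T.length +
      (C.T.length + C.T.length) = 4 * C.T.length by ring]
  simp only [key]
  constructor
  · rintro ⟨j, hj⟩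
    exact ⟨j, A[j], by simp, hj⟩
  · rintro ⟨j, c, hj, hd⟩
    obtain ⟨hlt, rfl⟩ := List.getElem?_eq_some_iff.1 hj
    exact ⟨⟨j, hlt⟩, hd⟩

end

/-! ### The steps of one iteration -/

namespace HExpr

def terminal : HExpr :=
  find 10 0 (and (unmarked 10 11) (all 11 0 (or (neg (unmarked 11 12))
    (le (distG 14 (reg 11) (lit 0)) (distG 14 (reg 10) (lit 0))))))

def topBag : HExpr :=
  find 10 1 (and (inBag (reg 10) (reg 6)) (all 11 1 (or (neg (inBag (reg 11) (reg 6)))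
    (le (distT 12 (reg 10) (reg 5)) (distT 12 (reg 11) (reg 5))))))

/-- The bag in register `7` is not the last one of the climb. -/
def climbing : HExpr :=
  neg (or (eq (reg 7) (reg 5)) (all 10 0 (or (neg (inBag (reg 7) (reg 10)))
    (le (reg 3) (distG 11 (reg 10) (reg 6))))))

def parent : HExpr :=
  find 10 1 (and (adjT (reg 7) (reg 10))
    (eq (add (distT 11 (reg 10) (reg 5)) (lit 1)) (distT 11 (reg 7) (reg 5))))

def activator : HExpr := find 10 0 (inBag (reg 7) (reg 10))

def someUnmarked : HExpr := ex 10 0 (unmarked 10 11)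

end HExpr

section

variable {C : Call} {A : List (Fin C.n)} {s : RamState}

theorem Call.State.holds_someUnmarked (h : C.State A s) :
    HExpr.someUnmarked.Holds s ↔ marked C.T C.g A ≠ Set.univ := by
  rw [HExpr.someUnmarked, HExpr.holds_ex h.base.ctx.reg_zero, Set.ne_univ_iff_exists_notMem]
  refine exists_congr fun u => ?_
  exact (h.setReg (x := 10) u (by norm_num)).holds_unmarked (by norm_num) (by norm_num) u (by simp)

theorem Call.State.val_terminal (h : C.State A s) (hM : marked C.T C.g A ≠ Set.univ) :
    ∃ t : Fin C.n, HExpr.terminal.val s = t ∧ IsTerminal C.G C.o (marked C.T C.g A) t := by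
  have hbody : ∀ t : Fin C.n, (HExpr.and (.unmarked 10 11) (.all 11 0 (.or (.neg (.unmarked 11 12))
      (.le (.distG 14 (.reg 11) (.lit 0)) (.distG 14 (.reg 10) (.lit 0)))))).Holds
      (s.setReg 10 t) ↔ IsTerminal C.G C.o (marked C.T C.g A) t := by
    intro t
    have h1 := h.setReg (x := 10) t (by norm_num)
    rw [HExpr.holds_and, h1.holds_unmarked (by norm_num) (by norm_num) t (by simp),
      HExpr.holds_all h1.base.ctx.reg_zero, IsTerminal]
    refine and_congr_right fun _ => forall_congr' fun u => ?_
    have h2 := h1.setReg (x := 11) u (by norm_num)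
    rw [HExpr.holds_or, HExpr.holds_neg, HExpr.holds_le,
      h2.holds_unmarked (by norm_num) (by norm_num) u (by simp),
      h2.base.ctx.val_distG (by norm_num) u C.o (by simp) (by simp [C.o_eq]),
      h2.base.ctx.val_distG (by norm_num) t C.o (by simp) (by simp [C.o_eq]), imp_iff_not_or]
  obtain ⟨u, hu⟩ := (Set.ne_univ_iff_exists_notMem _).1 hM
  classical
  obtain ⟨t, ht, hmax⟩ := Finset.exists_max_image
    (Finset.univ.filter fun u => u ∉ marked C.T C.g A) (fun u => C.G.dist u C.o) ⟨u, by simpa⟩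
  obtain ⟨t', ht', h'⟩ := HExpr.exists_val_find h.base.ctx.reg_zero
    ⟨t, (hbody t).2 ⟨by simpa using ht, fun u hu => hmax u (by simpa using hu)⟩⟩
  exact ⟨t', ht', (hbody t').1 h'⟩

theorem Call.Base.val_topBag (h : C.Base s) {t : Fin C.n} (ht : s.reg 6 = t) :
    ∃ b : Fin C.m, HExpr.topBag.val s = b ∧ IsTopBag C.T C.r t b := by
  have hbody : ∀ b : Fin C.m, (HExpr.and (.inBag (.reg 10) (.reg 6)) (.all 11 1
      (.or (.neg (.inBag (.reg 11) (.reg 6)))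
        (.le (.distT 12 (.reg 10) (.reg 5)) (.distT 12 (.reg 11) (.reg 5)))))).Holds
      (s.setReg 10 b) ↔ IsTopBag C.T C.r t b := by
    intro b
    have h1 := h.setReg (x := 10) b (by norm_num)
    rw [HExpr.holds_and, h1.ctx.holds_inBag b t (by simp) (by simp [ht]),
      HExpr.holds_all h1.ctx.reg_one, IsTopBag]
    refine and_congr_right fun _ => forall_congr' fun b' => ?_
    have h2 := h1.setReg (x := 11) b' (by norm_num)
    rw [HExpr.holds_or, HExpr.holds_neg, HExpr.holds_le,
      h2.ctx.holds_inBag b' t (by simp) (by simp [ht]),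
      h2.ctx.val_distT (by norm_num) b C.r (by simp) (by simp [h.reg_five]),
      h2.ctx.val_distT (by norm_num) b' C.r (by simp) (by simp [h.reg_five]), imp_iff_not_or]
  obtain ⟨⟨b₀, hb₀⟩⟩ := (C.T.connected t).nonempty
  classical
  obtain ⟨b, hb, hmin⟩ := Finset.exists_min_image
    (Finset.univ.filter fun b => t ∈ C.T.bag b) (fun b => C.T.tree.dist b C.r)
    ⟨b₀, by simpa using hb₀⟩
  obtain ⟨b', hb', h'⟩ := HExpr.exists_val_find h.ctx.reg_one
    ⟨b, (hbody b).2 ⟨by simpa using hb, fun u hu => hmin u (by simpa using hu)⟩⟩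
  exact ⟨b', hb', (hbody b').1 h'⟩

theorem Call.Base.holds_climbing (h : C.Base s) {t : Fin C.n} {b : Fin C.m} (ht : s.reg 6 = t)
    (hb : s.reg 7 = b) :
    HExpr.climbing.Holds s ↔ ¬ (b = C.r ∨ ∀ v ∈ C.T.bag b, C.g ≤ C.G.dist v t) := by
  rw [HExpr.climbing, HExpr.holds_neg, HExpr.holds_or, HExpr.holds_eq,
    HExpr.holds_all h.ctx.reg_zero]
  simp only [HExpr.val_reg, hb, h.reg_five, ← Fin.ext_iff]
  refine not_congr (or_congr_right (forall_congr' fun v => ?_))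
  have h1 := h.setReg (x := 10) v (by norm_num)
  rw [HExpr.holds_or, HExpr.holds_neg, HExpr.holds_le,
    h1.ctx.holds_inBag b v (by simp [hb]) (by simp),
    h1.ctx.val_distG (by norm_num) v t (by simp) (by simp [ht]), imp_iff_not_or, HExpr.val_reg,
    h1.reg_three]

/-- The second node of a geodesic to the root is a parent. -/
theorem exists_isParent {V ι : Type*} {G : SimpleGraph V} (T : TreeDecomposition G ι) {r b : ι}
    (h : b ≠ r) : ∃ p, IsParent T r b p := by
  have hc := T.isTree.connected
  obtain ⟨p, hp⟩ := hc.exists_walk_length_eq_dist b r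
  cases p with
  | nil => exact absurd rfl h
  | cons hadj q =>
    rename_i w
    refine ⟨w, hadj, ?_⟩
    simp only [SimpleGraph.Walk.length_cons] at hp
    have h1 := SimpleGraph.dist_le q
    have h2 : T.tree.dist b r ≤ T.tree.dist b w + T.tree.dist w r := hc.dist_triangle
    have h3 : T.tree.dist b w = 1 := SimpleGraph.dist_eq_one_iff_adj.2 hadj
    omega

theorem Call.Base.val_parent (h : C.Base s) {b : Fin C.m} (hb : s.reg 7 = b) (hr : b ≠ C.r) :
    ∃ p : Fin C.m, HExpr.parent.val s = p ∧ IsParent C.T C.r b p := by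
  have hbody : ∀ p : Fin C.m, (HExpr.and (.adjT (.reg 7) (.reg 10))
      (.eq (.add (.distT 11 (.reg 10) (.reg 5)) (.lit 1)) (.distT 11 (.reg 7) (.reg 5)))).Holds
      (s.setReg 10 p) ↔ IsParent C.T C.r b p := by
    intro p
    have h1 := h.setReg (x := 10) p (by norm_num)
    rw [HExpr.holds_and, HExpr.holds_eq, HExpr.val_add, HExpr.val_lit,
      h1.ctx.holds_adjT b p (by simp [hb]) (by simp),
      h1.ctx.val_distT (by norm_num) p C.r (by simp) (by simp [h.reg_five]),
      h1.ctx.val_distT (by norm_num) b C.r (by simp [hb]) (by simp [h.reg_five]), IsParent]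
  obtain ⟨p, hp⟩ := exists_isParent C.T hr
  obtain ⟨p', hp', h'⟩ := HExpr.exists_val_find h.ctx.reg_one ⟨p, (hbody p).2 hp⟩
  exact ⟨p', hp', (hbody p').1 h'⟩

theorem Call.Base.val_activator (h : C.Base s) {b : Fin C.m} (hb : s.reg 7 = b)
    (hne : ∃ c, c ∈ C.T.bag b) : ∃ c : Fin C.n, HExpr.activator.val s = c ∧ c ∈ C.T.bag b := by
  have hbody : ∀ c : Fin C.n, (HExpr.inBag (.reg 7) (.reg 10)).Holds (s.setReg 10 c) ↔
      c ∈ C.T.bag b := fun c =>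
    (h.setReg (x := 10) c (by norm_num)).ctx.holds_inBag b c (by simp [hb]) (by simp)
  obtain ⟨c, hc⟩ := hne
  obtain ⟨c', hc', h'⟩ := HExpr.exists_val_find h.ctx.reg_zero ⟨c, (hbody c).2 hc⟩
  exact ⟨c', hc', (hbody c').1 h'⟩

end

/-! ### One call of the procedure -/

open HExpr RamCmd in
/-- One iteration of the main loop. -/
def iterProg : RamCmd :=
  .seq (set 6 terminal) (.seq (set 7 topBag) (.seq (whileDo climbing (set 7 parent))
    (.seq (put 3 (reg 2) activator) (set 2 (add (reg 2) (lit 1))))))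

open HExpr RamCmd in
/-- One call of the procedure. -/
def callProg : RamCmd :=
  .seq (set 2 (lit 0)) (whileDo (and (le (reg 2) (reg 3)) someUnmarked) iterProg)

/-- In the loop of `iterProg` that climbs in the tree. -/
def Call.ClimbInv (C : Call) (i : ℕ) (s : RamState) : Prop :=
  ∃ (A : List (Fin C.n)) (t : Fin C.n) (b b' : Fin C.m), C.State A s ∧ s.reg 2 = i ∧ i ≤ C.g ∧ IsTerminal C.G C.o (marked C.T C.g A) t ∧
    s.reg 6 = (t : ℕ) ∧ IsTopBag C.T C.r t b ∧ s.reg 7 = (b' : ℕ) ∧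
    -- `Climb` grows at its lower end while the program walks upwards; the part already walked is
    -- therefore kept as a map that prepends it.
    ∀ b'', Climb C.T C.r C.g t b' b'' → Climb C.T C.r C.g t b b''

/-- The depth of the bag in register `7`. -/
noncomputable def Call.depth (C : Call) (s : RamState) : ℕ :=
  if h : s.reg 7 < C.m then C.T.tree.dist ⟨s.reg 7, h⟩ C.r else 0

theorem Call.depth_eq {C : Call} {s : RamState} {b : Fin C.m} (h : s.reg 7 = b) :
    C.depth s = C.T.tree.dist b C.r := by
  simp only [depth, h, Fin.is_lt, dite_true, Fin.eta]

theorem climbProg_spec :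
    Triple (fun b : Call × ℕ => b.1.size) (fun b s => b.1.ClimbInv b.2 s)
      (.whileDo .climbing (.set 7 .parent))
      (fun b s => b.1.ClimbInv b.2 s ∧ HExpr.climbing.val s = 0) := by
  refine Triple.whileDo (fun b s => b.1.depth s) Polynomial.X (by rfl) ?_ ?_
  · rintro ⟨C, i⟩ s ⟨A, t, b, b', hS, hi, hg, ht, h6, hb, h7, hc⟩
    refine ⟨hS.base.bounded, ?_⟩
    rw [Polynomial.eval_X, C.depth_eq h7]
    exact (dist_lt_card C.T.isTree.connected _ _).le.trans (Nat.le_add_left _ _)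
  · refine Triple.set (by rfl) (by norm_num) ?_
    rintro ⟨⟨C, i⟩, j⟩ s ⟨⟨A, t, b, b', hS, hi, hg, ht, h6, hb, h7, hc⟩, hcl, hμ⟩
    simp only at hS hi hg ht h6 hb h7 hc hcl hμ
    have hcl' := (hS.base.holds_climbing h6 h7).1 hcl
    push Not at hcl'
    obtain ⟨p, hp, hpar⟩ := hS.base.val_parent h7 hcl'.1
    refine ⟨hS.base.bounded, ⟨A, t, b, p, hS.setReg _ (by norm_num), by simpa using hi, hg, ht,
      by simpa using h6, hb, by simp [hp], fun b'' h => hc _ (.move _ _ _ hcl'.1 hcl'.2 hpar h)⟩,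
      ?_⟩
    simp only
    rw [C.depth_eq (b := p) (by simp [hp]), ← hμ, C.depth_eq h7, ← hpar.2]
    exact Nat.lt_succ_self _

theorem iterProg_spec :
    Triple (fun b : Call × ℕ => b.1.size)
      (fun b s => (∃ A, b.1.State A s ∧ marked b.1.T b.1.g A ≠ Set.univ) ∧ s.reg 2 = b.2 ∧
        b.2 ≤ b.1.g) iterProg
      (fun b s => (∃ A, b.1.State A s) ∧ s.reg 2 = b.2 + 1) := by
  refine Triple.seq (Mid := fun b s => ∃ (A : List (Fin b.1.n)) (t : Fin b.1.n), b.1.State A s ∧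
    s.reg 2 = b.2 ∧ b.2 ≤ b.1.g ∧ IsTerminal b.1.G b.1.o (marked b.1.T b.1.g A) t ∧ s.reg 6 = (t : ℕ)) ?_ ?_
  · refine Triple.set (by rfl) (by norm_num) ?_
    rintro ⟨C, i⟩ s ⟨⟨A, hS, hM⟩, hi, hg⟩
    obtain ⟨t, ht, ht'⟩ := hS.val_terminal hM
    exact ⟨hS.base.bounded, A, t, hS.setReg _ (by norm_num), by simpa using hi, hg, ht',
      by simp [ht]⟩
  refine Triple.seq (Mid := fun b s => b.1.ClimbInv b.2 s) ?_ (climbProg_spec.seq ?_)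
  · refine Triple.set (by rfl) (by norm_num) ?_
    rintro ⟨C, i⟩ s ⟨A, t, hS, hi, hg, ht, h6⟩
    obtain ⟨b, hb, hb'⟩ := hS.base.val_topBag h6
    exact ⟨hS.base.bounded, A, t, b, b, hS.setReg _ (by norm_num), by simpa using hi, hg, ht,
      by simpa using h6, hb', by simp [hb], fun _ h => h⟩
  refine Triple.seq (Mid := fun b s => ∃ A : List (Fin b.1.n), b.1.Base s ∧
      (∀ (j : ℕ) (c : Fin b.1.n), A[j]? = some c → s.arr 3 j = c) ∧ s.reg 2 = b.2 ∧ b.2 ≤ b.1.g ∧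
      Reach b.1.T b.1.r b.1.o b.1.g (b.2 + 1) A (marked b.1.T b.1.g A)) ?_ ?_
  · refine Triple.put (by rfl) (by rfl) ?_
    rintro ⟨C, i⟩ s ⟨⟨A, t, b, b', hS, hi, hg, ht, h6, hb, h7, hc⟩, h0⟩
    simp only at hS hi hg ht h6 hb h7 hc
    have hlast := (hS.base.holds_climbing h6 h7).not.1 (HExpr.val_eq_zero_iff.1 h0)
    have hclimb := hc _ (.here b' (not_not.1 hlast))
    -- The final bag is non-empty: it separates a bag of `t` from the root, so a walk from `t` to
    -- the origin meets it.
    obtain ⟨w⟩ := C.conn.preconnected t C.o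
    obtain ⟨x, -, hx⟩ :=
      (separates_of_dist_add hclimb.dist_add).exists_mem w hb.1 C.mem
    obtain ⟨c, hcv, hcb⟩ := hS.base.val_activator h7 ⟨x, hx⟩
    have hlen : A.length = i := hS.reach.length_eq.1.trans hi
    have hM : marked C.T C.g A ≠ Set.univ := (Set.ne_univ_iff_exists_notMem _).2 ⟨t, ht.1⟩
    have hB := hS.base
    refine ⟨hB.bounded, A ++ [c], ⟨hB.ctx.setArr _ _, hB.reg_two, hB.reg_three, hB.reg_four,
      hB.reg_five⟩, ?_, hi, hg, ?_⟩
    · intro j d hj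
      rw [hcv]
      rcases lt_trichotomy j A.length with hlt | rfl | hgt
      · rw [List.getElem?_append_left hlt] at hj
        have : j ≠ s.reg 2 := by omega
        simpa [this] using hS.out j d hj
      · simp only [List.getElem?_concat_length, Option.some.injEq] at hj
        simp [hlen, hi, hj]
      · rw [List.getElem?_eq_none (by simp; omega)] at hj
        cases hj
    · have hr := hS.reach
      rw [hi] at hr
      have := Reach.iter i A _ t b b' c hr hg hM ht hb hclimb hcb
      rwa [marked_concat, hlen]
  · refine Triple.set (by rfl) (by norm_num) ?_
    rintro ⟨C, i⟩ s ⟨A, hB, hout, hi, hg, hr⟩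
    simp only at hB hout hi hg hr
    -- Register 2 bounds the searches over activators and must stay within the size: `i + 1 ≤ g + 1
    -- ≤ n + m`.
    have hsize : i + 1 ≤ C.size := by
      have := C.le_n
      have := C.m_pos
      simp only [Instance.size]
      omega
    refine ⟨hB.bounded, ⟨A, ⟨hB.ctx.setReg _ le_rfl, by simpa [hi] using hsize,
      by simpa using hB.reg_three, by simpa using hB.reg_four, by simpa using hB.reg_five⟩,
      hout, by simpa [hi] using hr⟩, by simp [hi]⟩

theorem callProg_spec :
    Triple (fun C : Call => C.size) (fun C s => C.Base s) callProg
      (fun C s => ∃ A, C.State A s ∧ (marked C.T C.g A = Set.univ ∨ C.g < s.reg 2)) := by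
  refine Triple.seq (Mid := fun C s => ∃ A, C.State A s) ?_ ?_
  · refine Triple.set (by rfl) (by norm_num) ?_
    intro C s hB
    refine ⟨hB.bounded, [], ⟨hB.ctx.setReg _ le_rfl, by simp, by simpa using hB.reg_three,
      by simpa using hB.reg_four, by simpa using hB.reg_five⟩, by simp, ?_⟩
    simpa [marked] using Reach.init (T := C.T) (r := C.r) (o := C.o) (g := C.g)
  · refine Triple.conseq (Triple.whileDo (size := fun C : Call => C.size)
      (I := fun C s => ∃ A, C.State A s) (fun C s => C.g + 1 - s.reg 2)
      (Polynomial.X + 1) (by rfl) ?_ ?_) ?_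
    · rintro C s ⟨A, hS⟩
      refine ⟨hS.base.bounded, ?_⟩
      have := C.le_n
      simp only [Polynomial.eval_add, Polynomial.eval_X, Polynomial.eval_one, Instance.size]
      omega
    · refine Triple.conseq iterProg_spec ?_
      rintro ⟨C, j⟩ s ⟨⟨A, hS⟩, he, hμ⟩
      simp only at hS hμ
      have he' := (HExpr.holds_and (s := s)).1 he
      rw [HExpr.holds_le, hS.holds_someUnmarked] at he'
      simp only [HExpr.val_reg, hS.base.reg_three] at he'
      refine ⟨(C, s.reg 2), le_rfl, ⟨⟨A, hS, he'.2⟩, rfl, he'.1⟩, ?_⟩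
      rintro s' ⟨hS', h2⟩
      refine ⟨hS', ?_⟩
      simp only at h2 ⊢
      omega
    · rintro C s ⟨A, hS⟩
      refine ⟨C, le_rfl, ⟨A, hS⟩, ?_⟩
      rintro s' ⟨⟨A', hS'⟩, h0⟩
      refine ⟨A', hS', ?_⟩
      rw [HExpr.val_eq_zero_iff, HExpr.holds_and, HExpr.holds_le, hS'.holds_someUnmarked] at h0
      simp only [HExpr.val_reg, hS'.base.reg_three] at h0
      by_contra! hcon
      exact h0 ⟨hcon.2, hcon.1⟩

/-! ### The program -/

open HExpr RamCmd in
/-- The program: it computes the distances, the length of the decomposition and a root bag with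
vertex `0`, and calls the procedure for `g = 1, 2, …` until it returns a schedule. -/
def burnProg : RamCmd :=
  .seq (distProg 0 4 0) (.seq (distProg 1 5 1) (.seq (set 4 HExpr.length)
    (.seq (set 5 (find 10 1 (inBag (reg 10) (lit 0)))) (.seq (set 3 (lit 1)) (.seq callProg
      (.seq (whileDo someUnmarked (.seq (set 3 (add (reg 3) (lit 1))) callProg))
        (set 0 (reg 2))))))))

/-- The state encodes the input. -/
structure Instance.Input (I : Instance) (s : RamState) : Prop where
  reg_zero : s.reg 0 = I.n
  reg_one : s.reg 1 = I.m
  reg_two : s.reg 2 = 0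
  adjG : ∀ u v : Fin I.n, s.arr 0 (u * I.n + v) ≠ 0 ↔ I.G.Adj u v
  adjT : ∀ i j : Fin I.m, s.arr 1 (i * I.m + j) ≠ 0 ↔ I.T.tree.Adj i j
  bag : ∀ (i : Fin I.m) (v : Fin I.n), s.arr 2 (i * I.n + v) ≠ 0 ↔ v ∈ I.T.bag i

theorem Instance.Input.bounded {I : Instance} {s : RamState} (h : I.Input s) :
    s.Bounded I.size := by
  intro y hy
  interval_cases y
  · rw [h.reg_zero]; exact Nat.le_add_right _ _
  · rw [h.reg_one]; exact Nat.le_add_left _ _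
  · rw [h.reg_two]; exact Nat.zero_le _

/-- The distances in the graph are in array `4`. -/
def DistGTable (I : Instance) (s : RamState) : Prop :=
  ∀ k u v : Fin I.n, s.arr 4 ((k * I.n + u) * I.n + v) ≠ 0 ↔ I.G.dist u v ≤ k

theorem distGProg_spec :
    Triple Instance.size Instance.Input (distProg 0 4 0) fun I s => I.Input s ∧ DistGTable I s := by
  refine Triple.conseq (distProg_spec 0 4 0 (by norm_num) (by norm_num)) ?_
  intro I s h
  refine ⟨⟨I.n, I.G, I.conn, s, I.size⟩, le_rfl, ⟨⟨h.reg_zero, h.bounded, h.adjG⟩, rfl⟩, ?_⟩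
  rintro s' ⟨h1, h2, h3⟩
  simp only at h1 h2 h3
  refine ⟨⟨by rw [h1 0 (by norm_num), h.reg_zero], by rw [h1 1 (by norm_num), h.reg_one],
    by rw [h1 2 (by norm_num), h.reg_two], ?_, ?_, ?_⟩, fun k u v => h3 k u v ?_⟩
  · rw [h2 0 (by norm_num)]; exact h.adjG
  · rw [h2 1 (by norm_num)]; exact h.adjT
  · rw [h2 2 (by norm_num)]; exact h.bag
  · exact DistInstance.index_lt (D := ⟨I.n, I.G, I.conn, s, I.size⟩) k u v

theorem distTProg_spec :
    Triple Instance.size (fun I s => I.Input s ∧ DistGTable I s) (distProg 1 5 1)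
      fun I s => Ctx I.G I.T s ∧ s.reg 2 = 0 := by
  refine Triple.conseq (distProg_spec 1 5 1 (by norm_num) (by norm_num)) ?_
  rintro I s ⟨h, hd⟩
  refine ⟨⟨I.m, I.T.tree, I.T.isTree.connected, s, I.size⟩, le_rfl,
    ⟨⟨h.reg_one, h.bounded, h.adjT⟩, rfl⟩, ?_⟩
  rintro s' ⟨h1, h2, h3⟩
  simp only at h1 h2 h3
  refine ⟨⟨I.conn, by rw [h1 0 (by norm_num), h.reg_zero], by rw [h1 1 (by norm_num), h.reg_one],
    ?_, ?_, ?_, fun k u v => h3 k u v ?_⟩, by rw [h1 2 (by norm_num), h.reg_two]⟩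
  · rw [h2 1 (by norm_num)]; exact h.adjT
  · rw [h2 2 (by norm_num)]; exact h.bag
  · rw [h2 4 (by norm_num)]; exact hd
  · exact DistInstance.index_lt (D := ⟨I.m, I.T.tree, I.T.isTree.connected, s, I.size⟩) k u v

theorem Ctx.bounded {I : Instance} {s : RamState} (h : Ctx I.G I.T s) (h2 : s.reg 2 = 0) :
    s.Bounded I.size := by
  intro y hy
  interval_cases y
  · rw [h.reg_zero]; exact Nat.le_add_right _ _
  · rw [h.reg_one]; exact Nat.le_add_left _ _
  · rw [h2]; exact Nat.zero_le _

/-- A call has been completed. -/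
def Instance.CallDone (I : Instance) (s : RamState) : Prop :=
  ∃ C : Call, C.toInstance = I ∧
    ∃ A, C.State A s ∧ (marked C.T C.g A = Set.univ ∨ C.g < s.reg 2)

theorem callProg_spec' :
    Triple Instance.size (fun I s => ∃ C : Call, C.toInstance = I ∧ C.Base s) callProg
      Instance.CallDone := by
  refine Triple.conseq callProg_spec ?_
  rintro I s ⟨C, rfl, hB⟩
  exact ⟨C, le_rfl, hB, fun s' h => ⟨C, rfl, h⟩⟩

theorem Call.State.burnGuess_none {C : Call} {A : List (Fin C.n)} {s : RamState}
    (h : C.State A s) (hM : marked C.T C.g A ≠ Set.univ) (hi : C.g < s.reg 2) :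
    BurnGuess C.T C.r C.o C.g none :=
  .noSchedule _ _ _ h.reach hM hi

theorem searchProg_spec :
    Triple Instance.size Instance.CallDone
      (.whileDo .someUnmarked (.seq (.set 3 (.add (.reg 3) (.lit 1))) callProg))
      fun I s => I.CallDone s ∧ HExpr.someUnmarked.val s = 0 := by
  refine Triple.whileDo (fun I s => I.n - s.reg 3) Polynomial.X (by rfl) ?_ ?_
  · rintro I s ⟨C, rfl, A, hS, -⟩
    rw [Polynomial.eval_X]
    exact ⟨hS.base.bounded, (Nat.sub_le _ _).trans (Nat.le_add_right _ _)⟩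
  · refine Triple.seq (Mid := fun b s => ∃ C : Call, C.toInstance = b.1 ∧ C.Base s ∧
      C.n - C.g < b.2) ?_ ?_
    · refine Triple.set (by rfl) (by norm_num) ?_
      rintro ⟨I, j⟩ s ⟨⟨C, rfl, A, hS, h⟩, he, hμ⟩
      simp only at hμ
      have hM := hS.holds_someUnmarked.1 he
      have hnone := hS.burnGuess_none hM (h.resolve_left hM)
      -- Failure forces `g < n`, so the next parameter is at most `n` and the measure `n - g` drops.
      have hlt : C.g < C.n := hnone.lt_card_of_none C.conn C.mem C.one_le
      have hB := hS.base
      refine ⟨hB.bounded, { C with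
        g := C.g + 1
        one_le := by omega
        le_n := hlt
        none_of_lt := fun g' h1 h2 => by
          rcases Nat.lt_succ_iff_lt_or_eq.1 h2 with h | rfl
          · exact C.none_of_lt g' h1 h
          · exact hnone }, rfl, ⟨hB.ctx.setReg _ (by norm_num), by simpa using hB.reg_two,
        by simp [hB.reg_three], by simpa using hB.reg_four, by simpa using hB.reg_five⟩, ?_⟩
      rw [hB.reg_three] at hμ
      simp only
      omega
    · refine Triple.conseq callProg_spec ?_
      rintro ⟨I, j⟩ s ⟨C, rfl, hB, hlt⟩
      refine ⟨C, le_rfl, hB, ?_⟩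
      rintro s' ⟨A, hS, h⟩
      refine ⟨⟨C, rfl, A, hS, h⟩, ?_⟩
      simp only [hS.base.reg_three]
      exact hlt

theorem burnProg_spec :
    Triple Instance.size Instance.Input burnProg fun I s => ∃ C : Call, C.toInstance = I ∧
      ∃ A : List (Fin C.n), BurnGuess C.T C.r C.o C.g (some A) ∧ s.reg 0 = A.length ∧
        ∀ (j : ℕ) (c : Fin C.n), A[j]? = some c → s.arr 3 j = c := by
  refine distGProg_spec.seq (distTProg_spec.seq ?_)
  refine Triple.seq (Mid := fun I s => (Ctx I.G I.T s ∧ s.reg 2 = 0) ∧ s.reg 4 = I.T.length) ?_ ?_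
  · refine Triple.set (by rfl) (by norm_num) ?_
    rintro I s ⟨h, h2⟩
    exact ⟨h.bounded h2, ⟨h.setReg _ (by norm_num), by simpa using h2⟩, by simp [h.val_length]⟩
  refine Triple.seq (Mid := fun I s => ((Ctx I.G I.T s ∧ s.reg 2 = 0) ∧ s.reg 4 = I.T.length) ∧
    ∃ (r : Fin I.m) (o : Fin I.n), o ∈ I.T.bag r ∧ (o : ℕ) = 0 ∧ s.reg 5 = r) ?_ ?_
  · refine Triple.set (by rfl) (by norm_num) ?_
    rintro I s ⟨⟨h, h2⟩, h4⟩
    let o : Fin I.n := ⟨0, Fin.pos (Classical.choice I.conn.nonempty)⟩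
    obtain ⟨⟨r₀, hr₀⟩⟩ := (I.T.connected o).nonempty
    have hbody : ∀ r : Fin I.m, (HExpr.inBag (.reg 10) (.lit 0)).Holds (s.setReg 10 r) ↔
        o ∈ I.T.bag r := fun r =>
      (h.setReg (x := 10) r (by norm_num)).holds_inBag r o (by simp) rfl
    obtain ⟨r, hr, hr'⟩ := HExpr.exists_val_find h.reg_one ⟨r₀, (hbody r₀).2 hr₀⟩
    exact ⟨h.bounded h2, ⟨⟨h.setReg _ (by norm_num), by simpa using h2⟩, by simpa using h4⟩,
      r, o, (hbody r).1 hr', rfl, by simp [hr]⟩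
  refine Triple.seq (Mid := fun I s => ∃ C : Call, C.toInstance = I ∧ C.Base s) ?_
    (callProg_spec'.seq (searchProg_spec.seq ?_))
  · refine Triple.set (by rfl) (by norm_num) ?_
    rintro I s ⟨⟨⟨h, h2⟩, h4⟩, r, o, hor, ho, h5⟩
    exact ⟨h.bounded h2, { I with
      r := r
      o := o
      mem := hor
      o_eq := ho
      g := 1
      one_le := le_rfl
      le_n := Fin.pos o
      none_of_lt := fun g' h1 h2 => by omega }, rfl, h.setReg _ (by norm_num), by simp [h2],
      by simp, by simpa using h4, by simpa using h5⟩
  · refine Triple.set (by rfl) (by norm_num) ?_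
    rintro I s ⟨⟨C, rfl, A, hS, -⟩, h0⟩
    have hM : marked C.T C.g A = Set.univ := by
      by_contra hM
      exact HExpr.val_eq_zero_iff.1 h0 (hS.holds_someUnmarked.2 hM)
    refine ⟨hS.base.bounded, C, rfl, A, .schedule _ A (hM ▸ hS.reach), ?_, hS.out⟩
    simp [hS.reach.length_eq.1]

/-! ### Input and output encodings. -/

theorem arr_inputState {n m : ℕ} (G : SimpleGraph (Fin n)) (T : TreeDecomposition G (Fin m)) :
    (∀ u v : Fin n, (inputState G T).arr 0 (u * n + v) ≠ 0 ↔ G.Adj u v) ∧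
    (∀ i j : Fin m, (inputState G T).arr 1 (i * m + j) ≠ 0 ↔ T.tree.Adj i j) ∧
    ∀ (i : Fin m) (v : Fin n), (inputState G T).arr 2 (i * n + v) ≠ 0 ↔ v ∈ T.bag i := by
  have inj : ∀ {k l : ℕ} {a a' : Fin k} {b b' : Fin l}, (a * l + b : ℕ) = a' * l + b' →
      a = a' ∧ b = b' := fun {k l a a' b b'} h =>
    (mul_add_inj b.2 b'.2 h).imp Fin.ext Fin.ext
  refine ⟨fun u v => ?_, fun i j => ?_, fun i v => ?_⟩
  · simp only [inputState, true_and, ne_eq, ite_eq_right_iff, one_ne_zero, imp_false, not_not,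
      zero_ne_one, OfNat.zero_ne_ofNat, false_and, or_false]
    exact ⟨fun ⟨u', v', h, he⟩ => by obtain ⟨rfl, rfl⟩ := inj he; exact h,
      fun h => ⟨u, v, h, rfl⟩⟩
  · simp only [inputState, true_and, ne_eq, ite_eq_right_iff, one_ne_zero, imp_false, not_not,
      OfNat.one_ne_ofNat, false_and, or_false, false_or]
    exact ⟨fun ⟨u', v', h, he⟩ => by obtain ⟨rfl, rfl⟩ := inj he; exact h,
      fun h => ⟨i, j, h, rfl⟩⟩
  · simp only [inputState, true_and, ne_eq, ite_eq_right_iff, one_ne_zero, imp_false, not_not,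
      OfNat.ofNat_ne_zero, OfNat.ofNat_ne_one, false_and, false_or]
    exact ⟨fun ⟨u', v', h, he⟩ => by obtain ⟨rfl, rfl⟩ := inj he; exact h,
      fun h => ⟨i, v, h, rfl⟩⟩

theorem input_inputState (I : Instance) : I.Input (inputState I.G I.T).view := by
  obtain ⟨h0, h1, h2⟩ := arr_inputState I.G I.T
  exact ⟨by simp [RamState.view, inputState], by simp [RamState.view, inputState],
    by simp [RamState.view, inputState], h0, h1, h2⟩

theorem output_eq {n : ℕ} {A : List (Fin n)} {s : RamState} (h0 : s.reg 0 = A.length)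
    (h : ∀ (j : ℕ) (c : Fin n), A[j]? = some c → s.arr 3 j = c) :
    s.output = A.map Fin.val := by
  refine List.ext_getElem (by simp [RamState.output, h0]) fun j h1 h2 => ?_
  rw [List.length_map] at h2
  simp only [RamState.output, List.getElem_map, List.getElem_range]
  exact h j A[j] (by simp)

end GraphBurning

/-! ### Assembly of the guarantees and the algorithm. -/

theorem mainTheorem4 :
    -- guarantees of every run of `BurnGuess`, for every root bag and every origin in it
    (∀ (n m : ℕ) (G : SimpleGraph (Fin n)) (T : TreeDecomposition G (Fin m)), G.Connected →
      ∀ (r : Fin m) (o : Fin n), o ∈ T.bag r → ∀ g : ℕ, 1 ≤ g →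
        (∀ A : List (Fin n), BurnGuess T r o g (some A) →
          BurnsWithin G A (2 * g + 4 * T.length + 1)) ∧
        (BurnGuess T r o g none →
          ∀ (S : List (Fin n)) (k : ℕ), BurnsWithin G S k → g < k)) ∧
    -- the polynomial-time algorithm
    (∃ (P : RamCmd) (p : Polynomial ℕ) (δ : ℕ → ℕ → ℝ),
      (∀ L : ℕ, Filter.Tendsto (δ L) Filter.atTop (nhds 0)) ∧
      ∀ (n m : ℕ) (G : SimpleGraph (Fin n)) (T : TreeDecomposition G (Fin m)), G.Connected →
        ∃ (final : RamState) (steps : ℕ) (A : List (Fin n)) (r : Fin m) (o : Fin n) (gStar : ℕ),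
          Exec P (inputState G T) final steps ∧
          steps ≤ p.eval (n + m) ∧
          final.output = A.map Fin.val ∧
          o ∈ T.bag r ∧
          1 ≤ gStar ∧
          BurnGuess T r o gStar (some A) ∧
          (∀ g : ℕ, 1 ≤ g → g < gStar → BurnGuess T r o g none) ∧
          BurnsWithin G A (2 * gStar + 4 * T.length + 1) ∧
          (∀ (S : List (Fin n)) (k : ℕ), BurnsWithin G S k → gStar ≤ k) ∧
          (burnTime G A : ℝ) ≤
            (2 + (4 * (T.length : ℝ) + 1) / (gStar : ℝ)) * (burningNumber G : ℝ) ∧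
          ∀ L : ℕ, T.length ≤ L →
            (4 * (T.length : ℝ) + 1) / (gStar : ℝ) ≤ δ L G.diam) := by
  refine ⟨fun n m G T hG r o ho g hg =>
    ⟨fun A hA => hA.burnsWithin hG hg, fun h S k hS => h.lt_of_none hG ho hg hS⟩, ?_⟩
  obtain ⟨p, hp⟩ := burnProg_spec
  refine ⟨burnProg, p, factorBound, tendsto_factorBound, fun n m G T hG => ?_⟩
  obtain ⟨s, k, hx, hk, ⟨I, r, o, ho, _, g, hg, _, hnone⟩, rfl, A, hA, h0, hout⟩ :=
    hp ⟨n, m, G, T, hG⟩ (inputState G T) (input_inputState ⟨n, m, G, T, hG⟩)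
  have hburn := hA.burnsWithin hG hg
  have hlow := le_of_burnsWithin hG ho hnone
  exact ⟨s, k, A, r, o, g, hx, hk, output_eq h0 hout, ho, hg, hA, hnone, hburn, hlow,
    burnTime_le_mul_burningNumber hg hburn hlow, fun L hL => hA.le_factorBound hG hg hL⟩
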